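/- Work in the triangular grid, whose edges are positively directed along three directions $a,b,c$ with $a+b+c=0$ (the projections of the unit vectors of $\mathbb Z^3$ along $(1,1,1)$), so that the three sides of every triangle form a directed cycle. Let $\mathcal D$ be a finite union of triangles that can be tiled by lozenges (unions of two adjacent triangles). A height function $h_T$ of a tiling $T$ is a function on vertices that increases by $1$ along each positively directed edge of $\mathcal D$ that does not cut a lozenge of $T$. Assume that $\mathcal D$ is a polygon (connected with connected complement) or, more generally, that any two tilings of $\mathcal D$ have height functions that coincide on the contour of $\mathcal D$. With heights so normalized, order the tilings by $T\preccurlyeq T'$ iff $h_T\le h_{T'}$ at every vertex of $\mathcal D$; $\mathrm{Min}(\mathcal D)$ and $\mathrm{Max}(\mathcal D)$ are the least and greatest tilings. A seed of $T$ is a hexagon of side $1$ on which $T$ induces the minimal tiling; it is located by its center and the height of that center. A pseudo-hexagon of $T$ with seed $s$ is given by a nonempty finite compact pile $P$ of unit cubes (a finite lower set of $\mathbb N^3$, with corner at $s$) such that the projections of the cubes of $P$ on the three base planes are lozenges of $T$; these lozenges form its minimal tiling. The range $r_T(s)$ is the union of the pseudo-hexagons of $T$ with seed $s$. The maximum range $R(s)$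 is the set of all cubes of the piles of pseudo-hexagons with seed $s$, over all tilings of $\mathcal D$ in which $s$ appears. A seed $s$ of $T$ is a proper seed of $T$ if $R(s)\subseteq R(s')$ holds for no seed $s'\neq s$ of $T$. Let $\mathcal D^0=\mathrm{Min}(\mathcal D)$. The proper seeds of order $n$ are the proper seeds of $\mathcal D^n$, and $\mathcal D^{n+1}$ is obtained from $\mathcal D^n$ by filling them maximally: on the range in $\mathcal D^n$ of each of them $\mathcal D^{n+1}$ is the maximal tiling of that range, and elsewhere it coincides with $\mathcal D^n$. (So $\mathcal D^n$ is obtained by maximally filling all proper seeds of order less than $n$.) Then the sequence $(\mathcal D^n)_{n\ge 0}$ exists and is unique; there is a least integer $d=d(\mathcal D)$ with $\mathcal D^{d}=\mathrm{Max}(\mathcal D)$; and the intervals $[\mathcal D^n,\mathcal D^{n+1}]$, $0\le n<d$, form a maximal chain of intervals running from $\mathrm{Min}(\mathcal D)$ to $\mathrm{Max}(\mathcal D)$. That is, $\mathcal D^0=\mathrm{Min}(\mathcal D)$, $\mathcal D^d=\mathrm{Max}(\mathcal D)$, $\mathcal D^n\prec\mathcal D^{n+1}$ for $0\le n<d$,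 and these intervals form a maximal chain in the set of intervals $[x,y]$ with $x\prec y$, where $[x,y]$ lies below $[x',y']$ when $y\preccurlyeq x'$. -/

import Mathlib

/-! Lozenge tilings of finite domains of the triangular grid. -/

namespace LozengeTiling

/-- Vertices of the triangular grid, in the lattice basis given by two of the three directions. -/
abbrev Vertex := ℤ × ℤ

/-- The three positive directions `a, b, c` of the grid; their sum is `0`.  They are the images of
the three unit vectors of `ℤ³` under the projection along `(1,1,1)`. -/
def dir : Fin 3 → Vertex := ![(1, 0), (0, 1), (-1, -1)]

/-- The positively directed edge `(v, i)` goes from `v` to `v + dir i`. -/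
abbrev Edge := Vertex × Fin 3

/-- The triangles of the grid: `(v, false)` has vertices `v, v + a, v + a + b`
and `(v, true)` has vertices `v, v + b, v + b + a`. -/
abbrev Tri := Vertex × Bool

/-- The vertices of a triangle. -/
def triVertices : Tri → Finset Vertex
  | (v, false) => {v, v + dir 0, v + dir 0 + dir 1}
  | (v, true) => {v, v + dir 1, v + dir 1 + dir 0}

/-- The sides of a triangle; positively directed, they form a cycle. -/
def triEdges : Tri → Finset Edge
  | (v, false) => {(v, 0), (v + dir 0, 1), (v + dir 0 + dir 1, 2)}
  | (v, true) => {(v, 1), (v + dir 1, 0), (v + dir 1 + dir 0, 2)}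

/-- A domain: a finite union of triangles of the grid. -/
abbrev Domain := Finset Tri

/-- `v` is a vertex of the domain. -/
def IsVertexOf (D : Domain) (v : Vertex) : Prop := ∃ t ∈ D, v ∈ triVertices t

/-- The contour: the edges that belong to exactly one triangle of the domain. -/
def IsContourEdge (D : Domain) (e : Edge) : Prop := ∃! t : Tri, t ∈ D ∧ e ∈ triEdges t

/-- The vertices that lie on the contour. -/
def IsContourVertex (D : Domain) (v : Vertex) : Prop :=
  ∃ e : Edge, IsContourEdge D e ∧ (v = e.1 ∨ v = e.1 + dir e.2)

/-- A polygon: a domain which is connected (as a closed subset of the plane, so triangles that share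
a vertex are connected) and whose complement is connected (as an open subset of the plane, so
triangles of the complement are connected through common sides). -/
def IsPolygon (D : Domain) : Prop :=
  (∀ t ∈ D, ∀ t' ∈ D, Relation.ReflTransGen
    (fun x y : Tri => x ∈ D ∧ y ∈ D ∧ ∃ v, v ∈ triVertices x ∧ v ∈ triVertices y) t t') ∧
  (∀ t, t ∉ D → ∀ t', t' ∉ D → Relation.ReflTransGen
    (fun x y : Tri => x ∉ D ∧ y ∉ D ∧ ∃ e, e ∈ triEdges x ∧ e ∈ triEdges y) t t')

/-- A lozenge is the union of the two triangles that share a given side; it is encoded by that side,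
which is the short diagonal of the lozenge. -/
abbrev Lozenge := Edge

/-- The lozenge is included in the domain. -/
def LozengeIn (l : Lozenge) (D : Domain) : Prop := ∀ t : Tri, l ∈ triEdges t → t ∈ D

/-- A tiling of `D`: lozenges included in `D` such that every triangle of `D` belongs to exactly one
of them. -/
@[ext]
structure Tiling (D : Domain) where
  lozenges : Finset Lozenge
  subset : ∀ l ∈ lozenges, LozengeIn l D
  cover : ∀ t ∈ D, ∃! l : Lozenge, l ∈ lozenges ∧ l ∈ triEdges t

variable {D : Domain}

/-- `h` is a height function of `T`: it increases by one along every positively directed edge of the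
domain that is valid for `T`, that is, that does not cut a lozenge of `T`. -/
def Tiling.IsHeight (T : Tiling D) (h : Vertex → ℤ) : Prop :=
  ∀ t ∈ D, ∀ e ∈ triEdges t, e ∉ T.lozenges → h (e.1 + dir e.2) = h e.1 + 1

/-- Two functions take the same values on the contour of `D`. -/
def AgreeOnContour (D : Domain) (h h' : Vertex → ℤ) : Prop :=
  ∀ v, IsContourVertex D v → h v = h' v

/-- The heights of the tilings of `D` are consistent: any two tilings have height functions that take
the same values on the contour. -/
def HasConsistentHeights (D : Domain) : Prop :=
  ∀ T T' : Tiling D, ∃ h h' : Vertex → ℤ,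
    T.IsHeight h ∧ T'.IsHeight h' ∧ AgreeOnContour D h h'

/-- The order on tilings: `T ≤ T'` when the height function of `T` is at most the one of `T'`, the
two being normalized so as to coincide on the contour. -/
instance : LE (Tiling D) where
  le T T' := ∃ h h' : Vertex → ℤ, T.IsHeight h ∧ T'.IsHeight h' ∧ AgreeOnContour D h h' ∧
    ∀ v, IsVertexOf D v → h v ≤ h' v

/-- `T` is the minimal tiling `Min(D)`. -/
def Tiling.IsMinimal (T : Tiling D) : Prop := ∀ T' : Tiling D, T ≤ T'

/-- `T` is the maximal tiling `Max(D)`. -/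
def Tiling.IsMaximal (T : Tiling D) : Prop := ∀ T' : Tiling D, T' ≤ T

/-! ### Cubes, pseudo-hexagons, seeds and their ranges -/

/-- A cube of `ℤ³`, encoded by the projection and the height of its lowest corner. -/
abbrev Cube := Vertex × ℤ

/-- A compact pile of cubes, in coordinates relative to the corner `0` (nonempty, so that it contains
the cube at the corner). -/
def IsCompactPile (P : Finset (Fin 3 → ℕ)) : Prop :=
  P.Nonempty ∧ IsLowerSet (P : Set (Fin 3 → ℕ))

/-- The projection of the point `p` of `ℤ³`, relative to an origin that projects onto `v`. -/
def point (v : Vertex) (p : Fin 3 → ℕ) : Vertex := v + ∑ j, p j • dir j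

/-- The lozenges of the minimal tiling of the pseudo-hexagon defined by the pile `P` with corner `v`:
the projections of the cubes of `P` onto the three base planes.  The unit square of `ℤ³` with lowest
corner above `u`, orthogonal to the axis `i`, is seen as the lozenge `(u - dir i, i)`. -/
def baseLozenges (v : Vertex) (P : Finset (Fin 3 → ℕ)) : Set Lozenge :=
  {l | ∃ p ∈ P, ∃ i : Fin 3, l = (point v (Function.update p i 0) - dir i, i)}

/-- The hexagon of side 1 with center `v` carries a seed in `T`, i.e. `T` induces its minimal
tiling. -/
def Tiling.HasSeed (T : Tiling D) (v : Vertex) : Prop := ∀ i : Fin 3, (v - dir i, i) ∈ T.lozenges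

/-- The pseudo-hexagon with seed at `v` defined by the compact pile `P` lies in the tiling `T`, on
which the cubes of `P` can therefore be piled. -/
def Tiling.HasPseudoHexagon (T : Tiling D) (v : Vertex) (P : Finset (Fin 3 → ℕ)) : Prop :=
  IsCompactPile P ∧ baseLozenges v P ⊆ T.lozenges

open Classical in
/-- The range of the seed at `v` in `T`: the union of the pseudo-hexagons of `T` with this seed. -/
noncomputable def Tiling.range (T : Tiling D) (v : Vertex) : Domain :=
  D.filter fun t => ∃ P, T.HasPseudoHexagon v P ∧ ∃ l ∈ baseLozenges v P, l ∈ triEdges t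

/-- The maximum range of the seed whose center is `s.1`, at height `s.2`, when heights on the contour
are normalized by `h`: the cubes that belong to its range in some tiling of `D`. -/
def maxRange (D : Domain) (h : Vertex → ℤ) (s : Cube) : Set Cube :=
  {c | ∃ (T : Tiling D) (k : Vertex → ℤ), T.IsHeight k ∧ AgreeOnContour D h k ∧ k s.1 = s.2 ∧
    ∃ P, T.HasPseudoHexagon s.1 P ∧ ∃ p ∈ P, c = (point s.1 p, s.2 + ∑ j, (p j : ℤ))}

/-- The tiling `T` has a proper seed at `v`: a seed whose maximum range is included in the maximum
range of no other seed of `T`. -/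
def Tiling.HasProperSeed (T : Tiling D) (v : Vertex) : Prop :=
  T.HasSeed v ∧ ∃ h : Vertex → ℤ, T.IsHeight h ∧
    ∀ v', T.HasSeed v' → maxRange D h (v, h v) ⊆ maxRange D h (v', h v') → v' = v

/-- `T'` is obtained from `T` by maximally filling the ranges of all the proper seeds of `T`: on each
of these ranges `T'` is the maximal tiling of the range, and elsewhere `T'` coincides with `T`. -/
def Tiling.IsMaxFilling (T T' : Tiling D) : Prop :=
  (∀ v, T.HasProperSeed v →
    ∃ U : Tiling (T.range v), U.IsMaximal ∧ U.lozenges ⊆ T'.lozenges) ∧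
  (∀ l ∈ T.lozenges, (∀ v, T.HasProperSeed v → ¬ LozengeIn l (T.range v)) → l ∈ T'.lozenges)

/-- `E n` is the tiling `Dⁿ`: `E 0` is the minimal tiling; the proper seeds of order `n` are the
proper seeds of `E n`; and `E (n + 1)` is obtained when those are maximally filled as well. -/
def IsFillingSequence (E : ℕ → Tiling D) : Prop :=
  (E 0).IsMinimal ∧ ∀ n, (E n).IsMaxFilling (E (n + 1))

/-- An interval `[lo, hi]` of the ordered set of tilings, not reduced to a single tiling. -/
structure TilingInterval (D : Domain) where
  lo : Tiling D
  hi : Tiling D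
  le : lo ≤ hi
  ne : lo ≠ hi

/-- The interval `I` lies below the interval `J` (they may share an end). -/
def TilingInterval.Precedes (I J : TilingInterval D) : Prop := I.hi ≤ J.lo

end LozengeTiling

open LozengeTiling

/-!
A height function of a tiling `T` is an antiderivative of the slope of `T`: the function on directed
edges equal to `-2` on the edges that cut a lozenge and to `1` on the others, whose circulation
around every triangle vanishes. If `T` is not maximal, then some tiling has a greater height
function, and at a well chosen vertex where the difference of the heights is greatest `T` has a
seed; conversely a tiling with a seed is not maximal, since the seed can be flipped.

The pseudo-hexagons of `T` with a given seed consist of lozenges of the tiling of the plane by three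
quadrants with apex at the seed. Hence the ranges of distinct seeds do not overlap, and on each
range the heights are consistent: a difference of heights that vanishes on the contour of `D`
propagates along rays outside the range up to the contour of the range. All proper seeds can
therefore be filled at once, in a unique way, and this does not decrease the tiling. A tiling that
is not maximal has a seed, hence a proper one: any seed whose maximum range is maximal for
inclusion. So the sequence is strictly increasing until it reaches the maximal tiling, which it does
because there are finitely many tilings. Finally, an interval comparable with all the consecutive
intervals of a monotone sequence from the minimum to the maximum has to be one of them.
-/

namespace LozengeTiling

variable {D : Domain}

/-! ### Edges, triangles and circulations -/

/-- The triangle of orientation `b` that has `e` as a side. -/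
def edgeTri (e : Edge) : Bool → Tri
  | false => (e.1 - ![0, dir 0, dir 0 + dir 1] e.2, false)
  | true => (e.1 - ![dir 1, 0, dir 1 + dir 0] e.2, true)

lemma mem_triEdges_iff {e : Edge} {t : Tri} : e ∈ triEdges t ↔ edgeTri e t.2 = t := by
  obtain ⟨⟨x, y⟩, i⟩ := e
  obtain ⟨⟨z, w⟩, b⟩ := t
  fin_cases i <;> cases b <;> simp [triEdges, edgeTri, dir] <;> omega

lemma mem_triEdges_edgeTri (e : Edge) (b : Bool) : e ∈ triEdges (edgeTri e b) := by
  rw [mem_triEdges_iff]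
  cases b <;> rfl

lemma card_triEdges (t : Tri) : (triEdges t).card = 3 := by
  obtain ⟨v, b⟩ := t
  cases b <;> exact Finset.card_eq_three.2
    ⟨_, _, _, by simp, by simp, by simp, rfl⟩

lemma fst_mem_triVertices {e : Edge} {t : Tri} (h : e ∈ triEdges t) : e.1 ∈ triVertices t := by
  obtain ⟨⟨x, y⟩, i⟩ := e
  obtain ⟨⟨z, w⟩, b⟩ := t
  fin_cases i <;> cases b <;> simp [triEdges, triVertices, dir] at h ⊢ <;> omega

lemma fst_add_dir_mem_triVertices {e : Edge} {t : Tri} (h : e ∈ triEdges t) :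
    e.1 + dir e.2 ∈ triVertices t := by
  obtain ⟨⟨x, y⟩, i⟩ := e
  obtain ⟨⟨z, w⟩, b⟩ := t
  fin_cases i <;> cases b <;> simp [triEdges, triVertices, dir] at h ⊢ <;> omega

/-- The circulation of `w` around a positively directed triangle. -/
def circulation (w : Edge → ℤ) (t : Tri) : ℤ := ∑ e ∈ triEdges t, w e

lemma circulation_false (w : Edge → ℤ) (v : Vertex) :
    circulation w (v, false) = w (v, 0) + w (v + dir 0, 1) + w (v + dir 0 + dir 1, 2) := by
  simp [circulation, triEdges, add_assoc]

lemma circulation_true (w : Edge → ℤ) (v : Vertex) :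
    circulation w (v, true) = w (v, 1) + w (v + dir 1, 0) + w (v + dir 1 + dir 0, 2) := by
  simp [circulation, triEdges, add_assoc]

lemma circulation_sub (w w' : Edge → ℤ) (t : Tri) :
    circulation (w - w') t = circulation w t - circulation w' t :=
  Finset.sum_sub_distrib ..

lemma circulation_update_of_notMem (w : Edge → ℤ) {t : Tri} {e : Edge} (he : e ∉ triEdges t)
    (z : ℤ) : circulation (Function.update w e z) t = circulation w t :=
  Finset.sum_update_of_notMem he w z

lemma circulation_update_of_mem (w : Edge → ℤ) {t : Tri} {e : Edge} (he : e ∈ triEdges t) (z : ℤ) :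
    circulation (Function.update w e z) t = circulation w t - w e + z := by
  rw [circulation, circulation, Finset.sum_update_of_mem he,
    Finset.sum_eq_add_sum_sdiff_singleton_of_mem he]
  ring

lemma circulation_eq_zero_iff {w : Edge → ℤ} {t : Tri} (hw : ∀ e ∈ triEdges t, w e = 1 ∨ w e = -2) :
    circulation w t = 0 ↔ ∃! e, w e = -2 ∧ e ∈ triEdges t := by
  have hcount : circulation w t = 3 - 3 * ((triEdges t).filter (w · = -2)).card := calc
    circulation w t = ∑ e ∈ triEdges t, (1 - 3 * if w e = -2 then (1 : ℤ) else 0) :=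
      Finset.sum_congr rfl fun e he => by rcases hw e he with h | h <;> simp [h]
    _ = _ := by
      rw [Finset.sum_sub_distrib, ← Finset.mul_sum, Finset.sum_boole]
      simp [card_triEdges]
  have hone : circulation w t = 0 ↔ ((triEdges t).filter (w · = -2)).card = 1 := by omega
  rw [hone, Finset.card_eq_one, Finset.singleton_iff_unique_mem]
  simp only [Finset.mem_filter, and_comm]

/-- The increment of `h` along a positively directed edge. -/
def inc (h : Vertex → ℤ) (e : Edge) : ℤ := h (e.1 + dir e.2) - h e.1

lemma inc_add (h g : Vertex → ℤ) (e : Edge) : inc (h + g) e = inc h e + inc g e := by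
  simp only [inc, Pi.add_apply]
  ring

lemma inc_sub (h g : Vertex → ℤ) (e : Edge) : inc (h - g) e = inc h e - inc g e := by
  simp only [inc, Pi.sub_apply]
  ring

lemma circulation_inc (h : Vertex → ℤ) (t : Tri) : circulation (inc h) t = 0 := by
  obtain ⟨⟨x, y⟩, b⟩ := t
  cases b <;> simp [circulation_false, circulation_true, inc, dir]

lemma eq_of_inc_eq_zero {g : Vertex → ℤ} {t : Tri} (hg : ∀ e ∈ triEdges t, inc g e = 0)
    {u u' : Vertex} (hu : u ∈ triVertices t) (hu' : u' ∈ triVertices t) : g u = g u' := by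
  obtain ⟨v, b⟩ := t
  cases b <;>
    simp only [triEdges, triVertices, inc, Finset.mem_insert, Finset.mem_singleton,
      forall_eq_or_imp, forall_eq] at hg hu hu' <;>
    rcases hu with rfl | rfl | rfl <;> rcases hu' with rfl | rfl | rfl <;> omega

lemma mem_triVertices_iff {v : Vertex} {t : Tri} :
    v ∈ triVertices t ↔ ∃ i, (v, i) ∈ triEdges t := by
  obtain ⟨⟨z, w⟩, b⟩ := t
  obtain ⟨x, y⟩ := v
  cases b
  · simp [triVertices, triEdges, dir, Fin.exists_fin_succ]
  · simp [triVertices, triEdges, dir, Fin.exists_fin_succ]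
    omega

lemma exists_mem_triEdges_of_consecutive (w : Vertex) {i k : Fin 3} (hik : i ≠ k) :
    ∃ t, (w - dir i, i) ∈ triEdges t ∧ (w, k) ∈ triEdges t := by
  obtain ⟨x, y⟩ := w
  refine ⟨edgeTri ((x, y), k) (decide (k = i + 2)), ?_, mem_triEdges_edgeTri _ _⟩
  fin_cases i <;> fin_cases k <;> first | exact absurd rfl hik | simp [triEdges, edgeTri, dir]

lemma add_dir_ne (v : Vertex) (i : Fin 3) : v + dir i ≠ v := by
  fin_cases i <;> simp [dir]

lemma add_nsmul_dir_injective (v : Vertex) (i : Fin 3) :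
    Function.Injective fun n : ℕ => v + n • dir i := by
  intro m n hmn
  have := add_left_cancel hmn
  fin_cases i <;> simp [dir] at this <;> omega

lemma walk_induction {s : Set Vertex} (hs : s.Finite) (i : Fin 3) {p : Vertex → Prop}
    (hout : ∀ v ∉ s, p v) (hstep : ∀ v ∈ s, p (v + dir i) → p v) (v : Vertex) : p v := by
  by_contra hv
  have hmem : ∀ u, ¬ p u → u ∈ s := fun u hu => by_contra fun h => hu (hout u h)
  have hwalk : ∀ n : ℕ, ¬ p (v + n • dir i) := fun n => by
    induction n with
    | zero => simpa using hv
    | succ n ih =>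
      rw [succ_nsmul, ← add_assoc]
      exact fun h => ih (hstep _ (hmem _ ih) h)
  exact Set.infinite_range_of_injective (add_nsmul_dir_injective v i)
    (hs.subset (Set.range_subset_iff.2 fun n => hmem _ (hwalk n)))

/-! ### The contour of a domain -/

/-- `e` is a side of a triangle of the domain. -/
def IsEdgeOf (D : Domain) (e : Edge) : Prop := ∃ t ∈ D, e ∈ triEdges t

/-- All the triangles around `v` belong to the domain. -/
def IsInteriorVertex (D : Domain) (v : Vertex) : Prop := ∀ t, v ∈ triVertices t → t ∈ D

lemma finite_setOf_isVertexOf (D : Domain) : {v | IsVertexOf D v}.Finite :=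
  (D.biUnion triVertices).finite_toSet.subset fun v hv => by simpa [IsVertexOf] using hv

lemma finite_setOf_isEdgeOf (D : Domain) : {e | IsEdgeOf D e}.Finite :=
  (D.biUnion triEdges).finite_toSet.subset fun e he => by
    obtain ⟨t, ht, het⟩ := he
    exact Finset.mem_coe.2 (Finset.mem_biUnion.2 ⟨t, ht, het⟩)

lemma IsVertexOf.mono {Q : Domain} (hQ : Q ⊆ D) {v : Vertex} : IsVertexOf Q v → IsVertexOf D v :=
  fun ⟨t, ht, hv⟩ => ⟨t, hQ ht, hv⟩

lemma IsEdgeOf.mono {Q : Domain} (hQ : Q ⊆ D) {e : Edge} : IsEdgeOf Q e → IsEdgeOf D e :=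
  fun ⟨t, ht, he⟩ => ⟨t, hQ ht, he⟩

lemma IsEdgeOf.isVertexOf_fst {e : Edge} : IsEdgeOf D e → IsVertexOf D e.1 :=
  fun ⟨t, ht, he⟩ => ⟨t, ht, fst_mem_triVertices he⟩

lemma IsEdgeOf.isVertexOf_fst_add_dir {e : Edge} : IsEdgeOf D e → IsVertexOf D (e.1 + dir e.2) :=
  fun ⟨t, ht, he⟩ => ⟨t, ht, fst_add_dir_mem_triVertices he⟩

lemma IsContourEdge.isEdgeOf {e : Edge} (he : IsContourEdge D e) : IsEdgeOf D e := he.exists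

lemma LozengeIn.isEdgeOf {l : Lozenge} (hl : LozengeIn l D) : IsEdgeOf D l :=
  ⟨_, hl _ (mem_triEdges_edgeTri l false), mem_triEdges_edgeTri l false⟩

lemma isContourEdge_of_mem_of_notMem {e : Edge} {t t' : Tri} (h : e ∈ triEdges t)
    (h' : e ∈ triEdges t') (ht : t ∈ D) (ht' : t' ∉ D) : IsContourEdge D e := by
  refine ⟨t, ⟨ht, h⟩, ?_⟩
  rintro s ⟨hs, hes⟩
  rw [mem_triEdges_iff] at h h' hes
  have hne : ∀ r ∈ D, edgeTri e r.2 = r → r.2 ≠ t'.2 := by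
    rintro r hr her hb
    rw [← h', ← hb, her] at ht'
    exact ht' hr
  have hst : s.2 = t.2 := by
    rw [Bool.eq_not_of_ne (hne s hs hes), Bool.eq_not_of_ne (hne t ht h)]
  rw [← hes, hst, h]

lemma IsContourEdge.exists_notMem {e : Edge} (h : IsContourEdge D e) :
    ∃ t, t ∉ D ∧ e ∈ triEdges t := by
  by_contra! hc
  have hmem : ∀ b, edgeTri e b ∈ D := fun b => by
    by_contra hb
    exact hc _ hb (mem_triEdges_edgeTri e b)
  have := h.unique ⟨hmem false, mem_triEdges_edgeTri e _⟩ ⟨hmem true, mem_triEdges_edgeTri e _⟩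
  simpa [edgeTri] using congrArg Prod.snd this

lemma IsInteriorVertex.isVertexOf {v : Vertex} (hv : IsInteriorVertex D v) : IsVertexOf D v :=
  ⟨(v, false), hv _ (by simp [triVertices]), by simp [triVertices]⟩

lemma IsContourVertex.isVertexOf {v : Vertex} (h : IsContourVertex D v) : IsVertexOf D v := by
  obtain ⟨e, he, rfl | rfl⟩ := h
  exacts [he.isEdgeOf.isVertexOf_fst, he.isEdgeOf.isVertexOf_fst_add_dir]

lemma IsContourVertex.exists_notMem {v : Vertex} (h : IsContourVertex D v) :
    ∃ t, t ∉ D ∧ v ∈ triVertices t := by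
  obtain ⟨e, he, hv⟩ := h
  obtain ⟨t, ht, het⟩ := he.exists_notMem
  refine ⟨t, ht, ?_⟩
  rcases hv with rfl | rfl
  exacts [fst_mem_triVertices het, fst_add_dir_mem_triVertices het]

lemma IsContourVertex.not_isInteriorVertex {v : Vertex} (h : IsContourVertex D v) :
    ¬ IsInteriorVertex D v := by
  obtain ⟨t, ht, hv⟩ := h.exists_notMem
  exact fun hint => ht (hint t hv)

-- Turning around `v`, membership in `D` does not change across any of the six edges at `v`.
lemma IsVertexOf.isInteriorVertex {v : Vertex} (hv : IsVertexOf D v)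
    (hc : ¬ IsContourVertex D v) : IsInteriorVertex D v := by
  have hcross : ∀ e : Edge, v = e.1 ∨ v = e.1 + dir e.2 →
      ∀ t t', e ∈ triEdges t → e ∈ triEdges t' → t ∈ D → t' ∈ D := by
    intro e he t t' h h' ht
    by_contra ht'
    exact hc ⟨e, isContourEdge_of_mem_of_notMem h h' ht ht', he⟩
  obtain ⟨s, hs, hvs⟩ := hv
  intro t hvt
  obtain ⟨i, hi⟩ := mem_triVertices_iff.1 hvs
  obtain ⟨k, hk⟩ := mem_triVertices_iff.1 hvt
  obtain ⟨j, hji, hjk⟩ : ∃ j, j ≠ i ∧ j ≠ k :=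
    (by decide : ∀ i k : Fin 3, ∃ j, j ≠ i ∧ j ≠ k) i k
  obtain ⟨r, hjr, hir⟩ := exists_mem_triEdges_of_consecutive v hji
  obtain ⟨r', hjr', hkr'⟩ := exists_mem_triEdges_of_consecutive v hjk
  have hr : r ∈ D := hcross _ (Or.inl rfl) s r hi hir hs
  have hr' : r' ∈ D := hcross _ (Or.inr (sub_add_cancel _ _).symm) r r' hjr hjr' hr
  exact hcross _ (Or.inl rfl) r' t hkr' hk hr'

lemma vertex_induction {p : Vertex → Prop} (hc : ∀ v, IsContourVertex D v → p v)
    (he : ∀ e, IsEdgeOf D e → p (e.1 + dir e.2) → p e.1) {v : Vertex} (hv : IsVertexOf D v) :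
    p v := by
  refine walk_induction (finite_setOf_isVertexOf D) 0 (p := fun v => IsVertexOf D v → p v)
    (fun _ hu hu' => absurd hu' hu) (fun u hu ih _ => ?_) v hv
  by_cases hcu : IsContourVertex D u
  · exact hc u hcu
  · have hedge : IsEdgeOf D (u, 0) :=
      ⟨(u, false), hu.isInteriorVertex hcu _ (by simp [triVertices]), by simp [triEdges]⟩
    exact he _ hedge (ih hedge.isVertexOf_fst_add_dir)

lemma eq_of_inc_eq {h h' : Vertex → ℤ} (hi : ∀ e, IsEdgeOf D e → inc h e = inc h' e)
    (hc : AgreeOnContour D h h') {v : Vertex} (hv : IsVertexOf D v) : h v = h' v := by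
  refine vertex_induction (p := fun v => h v = h' v) hc (fun e he heq => ?_) hv
  have := hi e he
  rw [inc, inc] at this
  omega

/-! ### Tilings and their height functions -/

lemma Tiling.eq_of_mem (T : Tiling D) {t : Tri} (ht : t ∈ D) {l l' : Lozenge}
    (hl : l ∈ T.lozenges) (hl' : l' ∈ T.lozenges) (hlt : l ∈ triEdges t) (hlt' : l' ∈ triEdges t) :
    l = l' :=
  (T.cover t ht).unique ⟨hl, hlt⟩ ⟨hl', hlt'⟩

lemma Tiling.not_consecutive (T : Tiling D) {w : Vertex} {i k : Fin 3} (hik : i ≠ k)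
    (hi : (w - dir i, i) ∈ T.lozenges) : (w, k) ∉ T.lozenges := by
  intro hk
  obtain ⟨t, hit, hkt⟩ := exists_mem_triEdges_of_consecutive w hik
  exact hik (congrArg Prod.snd (T.eq_of_mem (T.subset _ hi _ hit) hi hk hit hkt))

lemma exists_tiling_of_set {L : Set Lozenge} (hL : ∀ l ∈ L, LozengeIn l D)
    (hcover : ∀ t ∈ D, ∃! l, l ∈ L ∧ l ∈ triEdges t) :
    ∃ T : Tiling D, ∀ l, l ∈ T.lozenges ↔ l ∈ L := by
  have hfin : L.Finite := (finite_setOf_isEdgeOf D).subset fun l hl => (hL l hl).isEdgeOf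
  refine ⟨⟨hfin.toFinset, ?_, ?_⟩, fun l => hfin.mem_toFinset⟩
  · simpa only [Set.Finite.mem_toFinset] using hL
  · simpa only [Set.Finite.mem_toFinset] using hcover

instance : Finite (Tiling D) :=
  have := (finite_setOf_isEdgeOf D).finite_subsets.to_subtype
  Finite.of_injective
    (fun T : Tiling D => (⟨T.lozenges, fun _ hl => (T.subset _ hl).isEdgeOf⟩ :
      {s : Set Edge | s ⊆ {e | IsEdgeOf D e}}))
    fun _ _ h => Tiling.ext (Finset.coe_injective (congrArg Subtype.val h))

/-- The slope of a tiling along a positively directed edge: the increment that it prescribes to its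
height functions. -/
def Tiling.slope (T : Tiling D) (e : Edge) : ℤ := if e ∈ T.lozenges then -2 else 1

lemma Tiling.slope_eq_one_or (T : Tiling D) (e : Edge) : T.slope e = 1 ∨ T.slope e = -2 := by
  rw [slope]
  split_ifs <;> simp

lemma Tiling.slope_eq_neg_two_iff {T : Tiling D} {e : Edge} :
    T.slope e = -2 ↔ e ∈ T.lozenges := by
  rw [slope]
  split_ifs with h <;> simp [h]

lemma Tiling.slope_eq_one_iff {T : Tiling D} {e : Edge} : T.slope e = 1 ↔ e ∉ T.lozenges := by
  rw [slope]
  split_ifs with h <;> simp [h]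

lemma Tiling.slope_eq_one_of_notMem (T : Tiling D) {t : Tri} (ht : t ∉ D) {e : Edge}
    (he : e ∈ triEdges t) : T.slope e = 1 :=
  slope_eq_one_iff.2 fun hm => ht (T.subset e hm t he)

lemma Tiling.slope_eq_one_of_isContourEdge (T : Tiling D) {e : Edge} (he : IsContourEdge D e) :
    T.slope e = 1 := by
  obtain ⟨t, ht, het⟩ := he.exists_notMem
  exact T.slope_eq_one_of_notMem ht het

lemma Tiling.circulation_slope (T : Tiling D) {t : Tri} (ht : t ∈ D) :
    circulation T.slope t = 0 := by
  rw [circulation_eq_zero_iff fun e _ => T.slope_eq_one_or e]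
  simpa only [slope_eq_neg_two_iff] using T.cover t ht

lemma Tiling.IsHeight.inc_eq_slope {T : Tiling D} {h : Vertex → ℤ} (hT : T.IsHeight h) {e : Edge}
    (he : IsEdgeOf D e) : inc h e = T.slope e := by
  obtain ⟨t, ht, het⟩ := he
  have hvalid : ∀ e' ∈ triEdges t, e' ∉ T.lozenges → inc h e' = T.slope e' := by
    intro e' he' hn
    rw [slope_eq_one_iff.2 hn, inc, hT t ht e' he' hn, add_sub_cancel_left]
  by_cases hm : e ∈ T.lozenges
  · have hsum : circulation (inc h - T.slope) t = 0 := by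
      rw [circulation_sub, circulation_inc, T.circulation_slope ht, sub_zero]
    have honly : ∀ e' ∈ triEdges t, e' ≠ e → (inc h - T.slope) e' = 0 := fun e' he' hne =>
      sub_eq_zero.2 (hvalid e' he' fun hm' => hne (T.eq_of_mem ht hm' hm he' het))
    rw [circulation, Finset.sum_eq_single_of_mem e het honly] at hsum
    exact sub_eq_zero.1 hsum
  · exact hvalid e het hm

lemma Tiling.isHeight_iff {T : Tiling D} {h : Vertex → ℤ} :
    T.IsHeight h ↔ ∀ e, IsEdgeOf D e → inc h e = T.slope e := by
  refine ⟨fun hT e he => hT.inc_eq_slope he, fun hT t ht e he hn => ?_⟩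
  have hinc := hT e ⟨t, ht, he⟩
  rw [slope_eq_one_iff.2 hn, inc] at hinc
  omega

lemma exists_isHeight_of_inc {h : Vertex → ℤ}
    (hi : ∀ e, IsEdgeOf D e → inc h e = 1 ∨ inc h e = -2)
    (hc : ∀ e, IsContourEdge D e → inc h e = 1) : ∃ T : Tiling D, T.IsHeight h := by
  obtain ⟨T, hT⟩ : ∃ T : Tiling D, ∀ l, l ∈ T.lozenges ↔ l ∈ {e | IsEdgeOf D e ∧ inc h e = -2} := by
    refine exists_tiling_of_set ?_ fun t ht => ?_
    · rintro l ⟨⟨s, hs, hls⟩, hl⟩ t hlt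
      by_contra ht
      have := hc l (isContourEdge_of_mem_of_notMem hls hlt hs ht)
      omega
    · obtain ⟨e, ⟨he, het⟩, huniq⟩ :=
        (circulation_eq_zero_iff fun e he => hi e ⟨t, ht, he⟩).1 (circulation_inc h t)
      exact ⟨e, ⟨⟨⟨t, ht, het⟩, he⟩, het⟩, fun e' he' => huniq e' ⟨he'.1.2, he'.2⟩⟩
  refine ⟨T, Tiling.isHeight_iff.2 fun e he => ?_⟩
  rcases hi e he with h1 | h2
  · rw [h1, eq_comm, Tiling.slope_eq_one_iff, hT]
    rintro ⟨-, h2⟩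
    omega
  · rw [h2, eq_comm, Tiling.slope_eq_neg_two_iff, hT]
    exact ⟨he, h2⟩

lemma Tiling.IsHeight.inc_eq_inc {T : Tiling D} {h h' : Vertex → ℤ} (hT : T.IsHeight h)
    (hT' : T.IsHeight h') {e : Edge} (he : IsEdgeOf D e) : inc h e = inc h' e := by
  rw [hT.inc_eq_slope he, hT'.inc_eq_slope he]

lemma Tiling.IsHeight.add {T : Tiling D} {h g : Vertex → ℤ} (hT : T.IsHeight h)
    (hg : ∀ e, IsEdgeOf D e → inc g e = 0) : T.IsHeight (h + g) := by
  rw [isHeight_iff]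
  intro e he
  rw [inc_add, hg e he, add_zero, hT.inc_eq_slope he]

section Subtiling

variable {Q : Domain} {S : Tiling Q} {T : Tiling D}

lemma Tiling.domain_subset (h : S.lozenges ⊆ T.lozenges) : Q ⊆ D := by
  intro t ht
  obtain ⟨l, ⟨hl, hlt⟩, -⟩ := S.cover t ht
  exact T.subset l (h hl) t hlt

lemma Tiling.mem_iff_of_subset (h : S.lozenges ⊆ T.lozenges) {e : Edge} (he : IsEdgeOf Q e) :
    e ∈ S.lozenges ↔ e ∈ T.lozenges := by
  refine ⟨fun hm => h hm, fun hm => ?_⟩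
  obtain ⟨t, ht, het⟩ := he
  obtain ⟨l, ⟨hl, hlt⟩, -⟩ := S.cover t ht
  rwa [T.eq_of_mem (domain_subset h ht) hm (h hl) het hlt]

lemma Tiling.slope_eq_of_subset (h : S.lozenges ⊆ T.lozenges) {e : Edge} (he : IsEdgeOf Q e) :
    S.slope e = T.slope e := by
  simp only [slope, mem_iff_of_subset h he]

lemma Tiling.IsHeight.of_subset {k : Vertex → ℤ} (hT : T.IsHeight k)
    (h : S.lozenges ⊆ T.lozenges) : S.IsHeight k :=
  isHeight_iff.2 fun e he => by
    rw [hT.inc_eq_slope (he.mono (domain_subset h)), slope_eq_of_subset h he]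

lemma Tiling.eq_of_subset {T T' : Tiling D} (h : T.lozenges ⊆ T'.lozenges) : T = T' :=
  Tiling.ext <| Finset.ext fun l =>
    ⟨fun hl => h hl, fun hl => (mem_iff_of_subset h (T'.subset l hl).isEdgeOf).2 hl⟩

end Subtiling

/-! ### The order on tilings -/

lemma Tiling.eq_of_height_eq {T T' : Tiling D} {h h' : Vertex → ℤ} (hT : T.IsHeight h)
    (hT' : T'.IsHeight h') (he : ∀ v, IsVertexOf D v → h v = h' v) : T = T' := by
  refine eq_of_subset fun l hl => ?_
  have hle := (T.subset l hl).isEdgeOf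
  rw [← slope_eq_neg_two_iff, ← hT'.inc_eq_slope hle, inc, ← he _ hle.isVertexOf_fst,
    ← he _ hle.isVertexOf_fst_add_dir, ← inc, hT.inc_eq_slope hle, slope_eq_neg_two_iff]
  exact hl

lemma Tiling.IsHeight.renormalize {T T' : Tiling D} {h k k' : Vertex → ℤ} (hT : T.IsHeight h)
    (hk : T.IsHeight k) (hk' : T'.IsHeight k') : T'.IsHeight (k' + (h - k)) :=
  hk'.add fun e he => by rw [inc_sub, hT.inc_eq_inc hk he, sub_self]

lemma Tiling.le_of_le {T T' : Tiling D} (hle : T ≤ T') {h h' : Vertex → ℤ} (hT : T.IsHeight h)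
    (hT' : T'.IsHeight h') (hc : AgreeOnContour D h h') {v : Vertex} (hv : IsVertexOf D v) :
    h v ≤ h' v := by
  obtain ⟨k, k', hk, hk', hkc, hkle⟩ := hle
  have hshift : h' v = (k' + (h - k)) v := by
    refine eq_of_inc_eq (fun e he => hT'.inc_eq_inc (hT.renormalize hk hk') he) (fun u hu => ?_) hv
    rw [← hc u hu, Pi.add_apply, Pi.sub_apply, ← hkc u hu, add_sub_cancel]
  have := hkle v hv
  rw [hshift, Pi.add_apply, Pi.sub_apply]
  omega

protected lemma Tiling.le_trans {T T' T'' : Tiling D} (hle : T ≤ T') (hle' : T' ≤ T'') :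
    T ≤ T'' := by
  obtain ⟨h, h', hT, hT', hc, hle⟩ := hle
  obtain ⟨k, k', hk, hk', hkc, hkle⟩ := hle'
  refine ⟨h, _, hT, hT'.renormalize hk hk', fun v hv => ?_, fun v hv => ?_⟩
  · rw [hc v hv, Pi.add_apply, Pi.sub_apply, ← hkc v hv, add_sub_cancel]
  · have := hle v hv
    have := hkle v hv
    rw [Pi.add_apply, Pi.sub_apply]
    omega

protected lemma Tiling.le_antisymm {T T' : Tiling D} (hle : T ≤ T') (hle' : T' ≤ T) : T = T' := by
  obtain ⟨h, h', hT, hT', hc, hle⟩ := hle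
  exact eq_of_height_eq hT hT' fun v hv =>
    (hle v hv).antisymm (le_of_le hle' hT' hT (fun u hu => (hc u hu).symm) hv)

lemma HasConsistentHeights.exists_isHeight (hD : HasConsistentHeights D) (T : Tiling D) :
    ∃ h, T.IsHeight h := by
  obtain ⟨h, -, hT, -⟩ := hD T T
  exact ⟨h, hT⟩

/-- The order on the tilings of a domain with consistent heights, reflexive because every tiling
has a height function. -/
abbrev HasConsistentHeights.partialOrder (hD : HasConsistentHeights D) :
    PartialOrder (Tiling D) where
  le_refl T := by
    obtain ⟨h, hT⟩ := hD.exists_isHeight T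
    exact ⟨h, h, hT, hT, fun _ _ => rfl, fun _ _ => le_rfl⟩
  le_trans _ _ _ := Tiling.le_trans
  le_antisymm _ _ := Tiling.le_antisymm

/-! ### Flips, minimal and maximal tilings -/

lemma Tiling.HasSeed.isInteriorVertex {T : Tiling D} {v : Vertex} (hs : T.HasSeed v) :
    IsInteriorVertex D v := by
  intro t ht
  obtain ⟨⟨x, y⟩, b⟩ := t
  obtain ⟨i, hi⟩ : ∃ i, (v - dir i, i) ∈ triEdges ((x, y), b) := by
    obtain ⟨z, w⟩ := v
    cases b <;> simp [triVertices, triEdges, dir, Fin.exists_fin_succ] at ht ⊢ <;> omega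
  exact T.subset _ (hs i) _ hi

lemma Tiling.HasSeed.notMem {T : Tiling D} {v : Vertex} (hs : T.HasSeed v) (k : Fin 3) :
    (v, k) ∉ T.lozenges := by
  obtain ⟨i, hi⟩ := exists_ne k
  exact T.not_consecutive hi (hs i)

lemma inc_single (v : Vertex) (n : ℤ) (e : Edge) : inc (Pi.single v n) e =
    (if e.1 + dir e.2 = v then n else 0) - if e.1 = v then n else 0 := by
  simp only [inc, Pi.single_apply]

lemma Tiling.HasSeed.exists_isHeight_flip {T : Tiling D} {v : Vertex} (hs : T.HasSeed v)
    {h : Vertex → ℤ} (hT : T.IsHeight h) : ∃ T' : Tiling D, T'.IsHeight (h + Pi.single v 3) := by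
  refine exists_isHeight_of_inc (fun e he => ?_) fun e he => ?_
  · rw [inc_add, inc_single, hT.inc_eq_slope he]
    by_cases hout : e.1 = v
    · have hin : e.1 + dir e.2 ≠ v := hout ▸ add_dir_ne _ _
      have hslope : T.slope e = 1 := by
        rw [slope_eq_one_iff, ← Prod.mk.eta (p := e), hout]
        exact hs.notMem e.2
      rw [if_pos hout, if_neg hin, hslope]
      omega
    · by_cases hin : e.1 + dir e.2 = v
      · have hslope : T.slope e = -2 := by
          have := hs e.2
          rwa [← hin, add_sub_cancel_right, ← slope_eq_neg_two_iff] at this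
        rw [if_neg hout, if_pos hin, hslope]
        omega
      · rw [if_neg hout, if_neg hin]
        simpa using T.slope_eq_one_or e
  · have hcontour : ∀ u, IsContourVertex D u → u ≠ v := by
      rintro u hu rfl
      exact hu.not_isInteriorVertex hs.isInteriorVertex
    rw [inc_add, inc_single, hT.inc_eq_slope he.isEdgeOf, T.slope_eq_one_of_isContourEdge he,
      if_neg (hcontour _ ⟨e, he, Or.inl rfl⟩), if_neg (hcontour _ ⟨e, he, Or.inr rfl⟩)]
    rfl

lemma Tiling.HasSeed.exists_le_ne {T : Tiling D} {v : Vertex} (hs : T.HasSeed v)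
    {h : Vertex → ℤ} (hT : T.IsHeight h) : ∃ T' : Tiling D, T ≤ T' ∧ T ≠ T' := by
  obtain ⟨T', hT'⟩ := hs.exists_isHeight_flip hT
  have hc : AgreeOnContour D h (h + Pi.single v 3) := by
    intro u hu
    have huv : u ≠ v := by
      rintro rfl
      exact hu.not_isInteriorVertex hs.isInteriorVertex
    simp [huv]
  refine ⟨T', ⟨h, _, hT, hT', hc, fun u _ => ?_⟩, ?_⟩
  · have : (0 : Vertex → ℤ) ≤ Pi.single v 3 := Pi.single_nonneg.2 (by norm_num)
    exact le_add_of_nonneg_right (this u)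
  · rintro rfl
    have := eq_of_inc_eq (fun e he => hT.inc_eq_inc hT' he) hc hs.isInteriorVertex.isVertexOf
    simp at this

lemma Tiling.IsMaximal.not_hasSeed {T : Tiling D} (hmax : T.IsMaximal) {h : Vertex → ℤ}
    (hT : T.IsHeight h) (v : Vertex) : ¬ T.HasSeed v := by
  intro hs
  obtain ⟨T', hle, hne⟩ := hs.exists_le_ne hT
  exact hne (Tiling.le_antisymm hle (hmax T'))

-- A seed is found at a vertex where `h' - h` is greatest, and `h` least among those vertices.
lemma Tiling.exists_hasSeed_of_lt {T T' : Tiling D} {h h' : Vertex → ℤ} (hT : T.IsHeight h)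
    (hT' : T'.IsHeight h') (hc : AgreeOnContour D h h') {w : Vertex} (hw : IsVertexOf D w)
    (hlt : h w < h' w) : ∃ v, T.HasSeed v := by
  obtain ⟨v, hv, hmax⟩ := Set.exists_max_image _ (fun v => toLex (h' v - h v, -h v))
    (finite_setOf_isVertexOf D) ⟨w, hw⟩
  replace hmax : ∀ u, IsVertexOf D u →
      h' u - h u < h' v - h v ∨ h' u - h u = h' v - h v ∧ h v ≤ h u := fun u hu => by
    simpa only [Prod.Lex.toLex_le_toLex, neg_le_neg_iff] using hmax u hu
  have hint : IsInteriorVertex D v := hv.isInteriorVertex fun hcv => by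
    have := hmax w hw
    have := hc v hcv
    omega
  refine ⟨v, fun i => ?_⟩
  have hedge : IsEdgeOf D (v - dir i, i) := by
    have hmem := mem_triEdges_edgeTri (v - dir i, i) false
    refine ⟨_, hint _ ?_, hmem⟩
    simpa using fst_add_dir_mem_triVertices hmem
  have hslope := hT.inc_eq_slope hedge
  have hslope' := hT'.inc_eq_slope hedge
  simp only [inc, sub_add_cancel] at hslope hslope'
  have hmax' : h' (v - dir i) - h (v - dir i) < h' v - h v ∨
      h' (v - dir i) - h (v - dir i) = h' v - h v ∧ h v ≤ h (v - dir i) :=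
    hmax _ hedge.isVertexOf_fst
  by_contra hn
  rw [slope_eq_one_iff.2 hn] at hslope
  rcases T'.slope_eq_one_or (v - dir i, i) with hone | htwo <;> omega

lemma HasConsistentHeights.exists_hasSeed (hD : HasConsistentHeights D) {T : Tiling D}
    (hT : ¬ T.IsMaximal) : ∃ v, T.HasSeed v := by
  obtain ⟨T', hle⟩ := not_forall.1 hT
  obtain ⟨h', h, hT', hTh, hc⟩ := hD T' T
  obtain ⟨w, hw, hlt⟩ : ∃ w, IsVertexOf D w ∧ h w < h' w := by
    by_contra! hcon
    exact hle ⟨h', h, hT', hTh, hc, hcon⟩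
  exact Tiling.exists_hasSeed_of_lt hTh hT' (fun v hv => (hc v hv).symm) hw hlt

lemma HasConsistentHeights.exists_isMaximal (hD : HasConsistentHeights D)
    [Nonempty (Tiling D)] : ∃ T : Tiling D, T.IsMaximal := by
  let := hD.partialOrder
  obtain ⟨T, -, hT⟩ := (Set.toFinite (Set.univ : Set (Tiling D))).exists_maximal Set.univ_nonempty
  refine ⟨T, by_contra fun hmax => ?_⟩
  obtain ⟨v, hs⟩ := hD.exists_hasSeed hmax
  obtain ⟨h, hh⟩ := hD.exists_isHeight T
  obtain ⟨T', hle, hne⟩ := hs.exists_le_ne hh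
  exact hne (hle.antisymm (hT (Set.mem_univ T') hle))

lemma Tiling.IsHeight.dvd_sub {T T' : Tiling D} {h h' : Vertex → ℤ} (hT : T.IsHeight h)
    (hT' : T'.IsHeight h') (hc : AgreeOnContour D h h') {v : Vertex} (hv : IsVertexOf D v) :
    3 ∣ h' v - h v := by
  refine vertex_induction (p := fun v => 3 ∣ h' v - h v) (fun v hv => by simp [hc v hv])
    (fun e he hdvd => ?_) hv
  have hslope := hT.inc_eq_slope he
  have hslope' := hT'.inc_eq_slope he
  rw [inc] at hslope hslope'
  rcases T.slope_eq_one_or e with h1 | h1 <;> rcases T'.slope_eq_one_or e with h2 | h2 <;> omega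

-- Two heights that differ do so by at least `3`, so their minimum has no steeper edge than they do.
lemma HasConsistentHeights.exists_le_le (hD : HasConsistentHeights D) (T T' : Tiling D) :
    ∃ M : Tiling D, M ≤ T ∧ M ≤ T' := by
  obtain ⟨h, h', hT, hT', hc⟩ := hD T T'
  have hslope : ∀ e, IsEdgeOf D e → h (e.1 + dir e.2) = h e.1 + T.slope e := fun e he => by
    rw [← hT.inc_eq_slope he, inc, add_sub_cancel]
  have hslope' : ∀ e, IsEdgeOf D e → h' (e.1 + dir e.2) = h' e.1 + T'.slope e := fun e he => by
    rw [← hT'.inc_eq_slope he, inc, add_sub_cancel]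
  obtain ⟨M, hM⟩ : ∃ M : Tiling D, M.IsHeight (h ⊓ h') := by
    refine exists_isHeight_of_inc (fun e he => ?_) fun e he => ?_
    · have hdvd := hT.dvd_sub hT' hc he.isVertexOf_fst
      rw [inc, Pi.inf_apply, Pi.inf_apply, hslope e he, hslope' e he]
      rcases T.slope_eq_one_or e with h1 | h1 <;> rcases T'.slope_eq_one_or e with h2 | h2 <;> omega
    · rw [inc, Pi.inf_apply, Pi.inf_apply, hslope e he.isEdgeOf, hslope' e he.isEdgeOf,
        T.slope_eq_one_of_isContourEdge he, T'.slope_eq_one_of_isContourEdge he]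
      omega
  refine ⟨M, ⟨_, h, hM, hT, fun v hv => ?_, fun v _ => min_le_left _ _⟩,
    ⟨_, h', hM, hT', fun v hv => ?_, fun v _ => min_le_right _ _⟩⟩
  · rw [Pi.inf_apply, hc v hv, min_self]
  · rw [Pi.inf_apply, hc v hv, min_self]

lemma HasConsistentHeights.exists_isMinimal (hD : HasConsistentHeights D)
    [Nonempty (Tiling D)] : ∃ T : Tiling D, T.IsMinimal := by
  let := hD.partialOrder
  obtain ⟨T, -, hT⟩ := (Set.toFinite (Set.univ : Set (Tiling D))).exists_minimal Set.univ_nonempty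
  refine ⟨T, fun T' => ?_⟩
  obtain ⟨M, hle, hle'⟩ := hD.exists_le_le T T'
  exact (hT (Set.mem_univ M) hle).trans hle'

lemma Tiling.IsMaximal.eq {T T' : Tiling D} (h : T.IsMaximal) (h' : T'.IsMaximal) : T = T' :=
  Tiling.le_antisymm (h' T) (h T')

lemma Tiling.IsMinimal.eq {T T' : Tiling D} (h : T.IsMinimal) (h' : T'.IsMinimal) : T = T' :=
  Tiling.le_antisymm (h T') (h' T)

/-! ### Polygons have consistent heights -/

lemma exists_antiderivative {G : Type*} [AddCommGroup G] (f : ℤ → G) :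
    ∃ F : ℤ → G, F 0 = 0 ∧ ∀ x, F (x + 1) - F x = f x := by
  refine ⟨fun x => ∑ i ∈ Finset.Ico 0 x, f i - ∑ i ∈ Finset.Ico x 0, f i, by simp, fun x => ?_⟩
  beta_reduce
  rcases le_or_gt 0 x with hx | hx
  · have hstep : Finset.Ico 0 (x + 1) = insert x (Finset.Ico 0 x) := by ext i; simp; omega
    rw [Finset.Ico_eq_empty_of_le hx, Finset.Ico_eq_empty_of_le (by omega : 0 ≤ x + 1), hstep,
      Finset.sum_insert Finset.right_notMem_Ico]
    simp
  · have hstep : Finset.Ico x 0 = insert x (Finset.Ico (x + 1) 0) := by ext i; simp; omega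
    rw [Finset.Ico_eq_empty_of_le hx.le, Finset.Ico_eq_empty_of_le (by omega : x + 1 ≤ 0), hstep,
      Finset.sum_insert (by simp)]
    simp

lemma eq_of_forall_mem_uIcc {α : Type*} {φ : ℤ → α} {y : ℤ}
    (hφ : ∀ j ∈ Set.uIcc 0 y, φ (j + 1) = φ j) : φ y = φ 0 := by
  induction y using Int.induction_on with
  | zero => rfl
  | succ n ih =>
    exact (hφ n (by simp [Set.mem_uIcc])).trans
      (ih fun j hj => hφ j (by rw [Set.mem_uIcc] at hj ⊢; omega))
  | pred n ih =>
    have hlast := hφ (-n - 1) Set.right_mem_uIcc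
    rw [sub_add_cancel] at hlast
    exact hlast.symm.trans (ih fun j hj => hφ j (by rw [Set.mem_uIcc] at hj ⊢; omega))

lemma eq_zero_of_circulation_eq_zero {u : Edge → ℤ} {S : Set Vertex}
    (hS : ∀ v ∈ S, ∀ y ∈ Set.uIcc 0 v.2, (v.1, y) ∈ S)
    (hu : ∀ v ∈ S, ∀ b, circulation u (v, b) = 0) (hone : ∀ v, u (v, 1) = 0)
    (hzero : ∀ x, u ((x, 0), 0) = 0) {t : Tri} (ht : t.1 ∈ S) {e : Edge} (he : e ∈ triEdges t) :
    u e = 0 := by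
  obtain ⟨v, b⟩ := t
  have hclosed : ∀ v ∈ S, u (v, 0) + u (v + dir 0 + dir 1, 2) = 0 ∧
      u (v + dir 1, 0) + u (v + dir 1 + dir 0, 2) = 0 := fun v hv => by
    have hf := hu v hv false
    have ht := hu v hv true
    rw [circulation_false, hone] at hf
    rw [circulation_true, hone] at ht
    constructor <;> omega
  have hstep : ∀ v ∈ S, u (v + dir 1, 0) = u (v, 0) := fun v hv => by
    have := hclosed v hv
    rw [add_right_comm] at this
    omega
  have hcolumn : u (v, 0) = 0 := by
    refine (eq_of_forall_mem_uIcc (φ := fun y => u ((v.1, y), 0)) fun y hy => ?_).trans (hzero v.1)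
    simpa [dir] using hstep _ (hS v ht y hy)
  have hup := hstep v ht
  have := hclosed v ht
  cases b <;> simp only [triEdges, Finset.mem_insert, Finset.mem_singleton] at he <;>
    rcases he with rfl | rfl | rfl <;> first | exact hone _ | omega

lemma exists_inc_eq {w : Edge → ℤ} {S : Set Vertex}
    (hS : ∀ v ∈ S, ∀ y ∈ Set.uIcc 0 v.2, (v.1, y) ∈ S)
    (hw : ∀ v ∈ S, ∀ b, circulation w (v, b) = 0) :
    ∃ h : Vertex → ℤ, ∀ t : Tri, t.1 ∈ S → ∀ e ∈ triEdges t, inc h e = w e := by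
  obtain ⟨F, -, hF⟩ := exists_antiderivative fun x => w ((x, 0), 0)
  choose G hG0 hG using fun x => exists_antiderivative fun y => w ((x, y), 1)
  refine ⟨fun v => F v.1 + G v.1 v.2, fun t ht e he => ?_⟩
  rw [eq_comm, ← sub_eq_zero]
  refine eq_zero_of_circulation_eq_zero (u := w - inc _) hS (fun v hv b => ?_) ?_ ?_ ht he
  · rw [circulation_sub, hw v hv, circulation_inc, sub_zero]
  · rintro ⟨x, y⟩
    simp [inc, dir, ← hG]
  · intro x
    simp [inc, dir, hG0, ← hF]

/-- The complement of `D` is connected as an open subset of the plane. -/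
def IsComplementConnected (D : Domain) : Prop :=
  ∀ t, t ∉ D → ∀ t', t' ∉ D → Relation.ReflTransGen
    (fun x y : Tri => x ∉ D ∧ y ∉ D ∧ ∃ e, e ∈ triEdges x ∧ e ∈ triEdges y) t t'

lemma IsComplementConnected.exists_isContourEdge (hD : IsComplementConnected D) {B : Domain}
    (hDB : D ⊂ B) : ∃ x ∈ B, x ∉ D ∧ ∃ e ∈ triEdges x, IsContourEdge B e := by
  obtain ⟨t₀, ht₀, ht₀D⟩ := Finset.exists_of_ssubset hDB
  obtain ⟨t₁, ht₁⟩ := Infinite.exists_notMem_finset B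
  by_contra! hcon
  have hin : ∀ t, Relation.ReflTransGen
      (fun x y : Tri => x ∉ D ∧ y ∉ D ∧ ∃ e, e ∈ triEdges x ∧ e ∈ triEdges y) t₀ t → t ∈ B := by
    intro t ht
    induction ht with
    | refl => exact ht₀
    | tail _ hxy hx =>
      obtain ⟨hxD, -, e, hex, hey⟩ := hxy
      by_contra hy
      exact hcon _ hx hxD e hex (isContourEdge_of_mem_of_notMem hex hey hx hy)
  exact ht₁ (hin t₁ (hD t₀ ht₀D t₁ fun ht => ht₁ (hDB.subset ht)))

-- Peel off `B` a triangle outside `D` with a free side: its value there can be chosen at will.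
lemma IsComplementConnected.exists_extension (hD : IsComplementConnected D) {w : Edge → ℤ}
    (hw : ∀ t ∈ D, circulation w t = 0) {B : Domain} (hDB : D ⊆ B) :
    ∃ w' : Edge → ℤ, (∀ t ∈ B, circulation w' t = 0) ∧ ∀ e, IsEdgeOf D e → w' e = w e := by
  induction B using Finset.strongInduction with
  | H B ih =>
    rcases hDB.eq_or_ssubset with rfl | hss
    · exact ⟨w, hw, fun _ _ => rfl⟩
    obtain ⟨x, hx, hxD, e, hex, he⟩ := hD.exists_isContourEdge hss
    have hDx : D ⊆ B.erase x := Finset.subset_erase.2 ⟨hDB, hxD⟩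
    obtain ⟨w', hw', hww'⟩ := ih _ (Finset.erase_ssubset hx) hDx
    have hfree : ∀ t ∈ B.erase x, e ∉ triEdges t := fun t ht het =>
      Finset.ne_of_mem_erase ht (he.unique ⟨Finset.mem_of_mem_erase ht, het⟩ ⟨hx, hex⟩)
    refine ⟨Function.update w' e (w' e - circulation w' x), fun t ht => ?_, fun f hf => ?_⟩
    · by_cases htx : t = x
      · rw [htx, circulation_update_of_mem w' hex]
        ring
      · have htB := Finset.mem_erase.2 ⟨htx, ht⟩
        rw [circulation_update_of_notMem w' (hfree t htB), hw' t htB]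
    · obtain ⟨t, ht, hft⟩ := hf
      have hfe : f ≠ e := by
        rintro rfl
        exact hfree t (hDx ht) hft
      rw [Function.update_of_ne hfe, hww' f ⟨t, ht, hft⟩]

lemma IsComplementConnected.exists_isHeight (hD : IsComplementConnected D) (T : Tiling D) :
    ∃ h, T.IsHeight h := by
  obtain ⟨N, hN⟩ : ∃ N : ℕ, ∀ t ∈ D, t.1.1.natAbs ≤ N ∧ t.1.2.natAbs ≤ N := by
    refine ⟨D.sup fun t => max t.1.1.natAbs t.1.2.natAbs, fun t ht => ?_⟩
    rw [← max_le_iff]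
    exact Finset.le_sup (f := fun t : Tri => max t.1.1.natAbs t.1.2.natAbs) ht
  let S : Finset Vertex := Finset.Icc (-N : ℤ) N ×ˢ Finset.Icc (-N : ℤ) N
  have hmem : ∀ v, v ∈ S ↔ v.1.natAbs ≤ N ∧ v.2.natAbs ≤ N := fun v => by
    simp only [S, Finset.mem_product, Finset.mem_Icc]
    omega
  have hDB : D ⊆ S ×ˢ Finset.univ := fun t ht =>
    Finset.mem_product.2 ⟨(hmem _).2 (hN t ht), Finset.mem_univ _⟩
  obtain ⟨w, hw, hwT⟩ := hD.exists_extension (fun t => T.circulation_slope) hDB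
  have hcolumn : ∀ v ∈ (S : Set Vertex), ∀ y ∈ Set.uIcc 0 v.2, (v.1, y) ∈ (S : Set Vertex) := by
    intro v hv y hy
    rw [Finset.mem_coe, hmem] at hv ⊢
    rw [Set.mem_uIcc] at hy
    constructor <;> omega
  obtain ⟨h, hh⟩ := exists_inc_eq hcolumn fun v hv b =>
    hw (v, b) (Finset.mem_product.2 ⟨hv, Finset.mem_univ b⟩)
  refine ⟨h, Tiling.isHeight_iff.2 fun e he => ?_⟩
  obtain ⟨t, ht, het⟩ := he
  rw [hh t (Finset.mem_product.1 (hDB ht)).1 e het, hwT e ⟨t, ht, het⟩]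

lemma IsComplementConnected.eq_of_inc_eq_zero (hD : IsComplementConnected D) {g : Vertex → ℤ}
    (hg : ∀ t, t ∉ D → ∀ e ∈ triEdges t, inc g e = 0) {t t' : Tri} (ht : t ∉ D) (ht' : t' ∉ D)
    {u u' : Vertex} (hu : u ∈ triVertices t) (hu' : u' ∈ triVertices t') : g u = g u' := by
  have hwalk := hD t ht t' ht'
  induction hwalk generalizing u' with
  | refl => exact LozengeTiling.eq_of_inc_eq_zero (hg t ht) hu hu'
  | tail _ hxy ih =>
    obtain ⟨hx, hy, e, hex, hey⟩ := hxy
    rw [ih hx (fst_mem_triVertices hex)]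
    exact LozengeTiling.eq_of_inc_eq_zero (hg _ hy) (fst_mem_triVertices hey) hu'

-- The slopes of two tilings agree off `D`, so their difference is closed on the whole plane.
lemma IsComplementConnected.hasConsistentHeights (hD : IsComplementConnected D) :
    HasConsistentHeights D := by
  intro T T'
  obtain ⟨h, hT⟩ := hD.exists_isHeight T
  have hclosed : ∀ t, circulation (T'.slope - T.slope) t = 0 := fun t => by
    by_cases ht : t ∈ D
    · rw [circulation_sub, T'.circulation_slope ht, T.circulation_slope ht, sub_zero]
    · exact Finset.sum_eq_zero fun e he => by
        rw [Pi.sub_apply, T'.slope_eq_one_of_notMem ht he, T.slope_eq_one_of_notMem ht he, sub_self]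
  obtain ⟨g, hg⟩ := exists_inc_eq (S := Set.univ) (fun _ _ _ _ => Set.mem_univ _)
    fun v _ b => hclosed (v, b)
  have hgout : ∀ t, t ∉ D → ∀ e ∈ triEdges t, inc g e = 0 := fun t ht e he => by
    rw [hg t (Set.mem_univ _) e he, Pi.sub_apply, T'.slope_eq_one_of_notMem ht he,
      T.slope_eq_one_of_notMem ht he, sub_self]
  obtain ⟨t₀, ht₀⟩ := Infinite.exists_notMem_finset D
  obtain ⟨e₀, he₀⟩ : (triEdges t₀).Nonempty := Finset.card_pos.1 (by simp [card_triEdges])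
  refine ⟨h, h + (g - fun _ => g e₀.1), hT, Tiling.isHeight_iff.2 fun e he => ?_, fun v hv => ?_⟩
  · obtain ⟨t, -, het⟩ := id he
    have hconst : inc (fun _ => g e₀.1) e = 0 := sub_self _
    rw [inc_add, inc_sub, hconst, hT.inc_eq_slope he, hg t (Set.mem_univ _) e het, Pi.sub_apply]
    ring
  · obtain ⟨t, ht, hvt⟩ := hv.exists_notMem
    have := hD.eq_of_inc_eq_zero hgout ht ht₀ hvt (fst_mem_triVertices he₀)
    rw [Pi.add_apply, Pi.sub_apply, this, sub_self, add_zero]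

/-! ### Retiling disjoint subdomains -/

section Retiling

variable {ι : Type*} {Q : ι → Domain} {S U : ∀ i, Tiling (Q i)} {T T' T'' : Tiling D}

/-- `T'` is obtained from `T` by retiling each subdomain `Q i` by `U i`. -/
def Tiling.IsRetiling (T : Tiling D) (U : ∀ i, Tiling (Q i)) (T' : Tiling D) : Prop :=
  (∀ i, (U i).lozenges ⊆ T'.lozenges) ∧
    ∀ l ∈ T.lozenges, (∀ i, ¬ LozengeIn l (Q i)) → l ∈ T'.lozenges

lemma Tiling.exists_isRetiling (hQ : Pairwise (Function.onFun Disjoint Q))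
    (hS : ∀ i, (S i).lozenges ⊆ T.lozenges) (U : ∀ i, Tiling (Q i)) :
    ∃ T' : Tiling D, T.IsRetiling U T' := by
  obtain ⟨T', hT'⟩ : ∃ T' : Tiling D, ∀ l, l ∈ T'.lozenges ↔
      l ∈ {l | (l ∈ T.lozenges ∧ ∀ i, ¬ LozengeIn l (Q i)) ∨ ∃ i, l ∈ (U i).lozenges} := by
    refine exists_tiling_of_set ?_ fun t ht => ?_
    · rintro l (⟨hl, -⟩ | ⟨i, hl⟩)
      · exact T.subset l hl
      · exact fun t ht => domain_subset (hS i) ((U i).subset l hl t ht)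
    · by_cases hi : ∃ i, t ∈ Q i
      · obtain ⟨i, hi⟩ := hi
        obtain ⟨l, ⟨hl, hlt⟩, huniq⟩ := (U i).cover t hi
        refine ⟨l, ⟨Or.inr ⟨i, hl⟩, hlt⟩, ?_⟩
        rintro l' ⟨⟨hl', hn⟩ | ⟨j, hl'⟩, hlt'⟩
        · exact absurd ((S i).subset l' ((mem_iff_of_subset (hS i) ⟨t, hi, hlt'⟩).2 hl')) (hn i)
        · obtain rfl := hQ.eq (Finset.not_disjoint_iff.2 ⟨t, hi, (U j).subset l' hl' t hlt'⟩)
          exact huniq l' ⟨hl', hlt'⟩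
      · push Not at hi
        obtain ⟨l, ⟨hl, hlt⟩, huniq⟩ := T.cover t ht
        refine ⟨l, ⟨Or.inl ⟨hl, fun i h => hi i (h t hlt)⟩, hlt⟩, ?_⟩
        rintro l' ⟨⟨hl', -⟩ | ⟨j, hl'⟩, hlt'⟩
        · exact huniq l' ⟨hl', hlt'⟩
        · exact absurd ((U j).subset l' hl' t hlt') (hi j)
  exact ⟨T', fun i l hl => (hT' l).2 (Or.inr ⟨i, hl⟩), fun l hl hn => (hT' l).2 (Or.inl ⟨hl, hn⟩)⟩

lemma Tiling.IsRetiling.unique (hT' : T.IsRetiling U T') (hT'' : T.IsRetiling U T'') :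
    T' = T'' := by
  have hcommon : ∀ t ∈ D, ∃ l ∈ triEdges t, l ∈ T'.lozenges ∧ l ∈ T''.lozenges := by
    intro t ht
    by_cases hi : ∃ i, t ∈ Q i
    · obtain ⟨i, hi⟩ := hi
      obtain ⟨l, ⟨hl, hlt⟩, -⟩ := (U i).cover t hi
      exact ⟨l, hlt, hT'.1 i hl, hT''.1 i hl⟩
    · obtain ⟨l, ⟨hl, hlt⟩, -⟩ := T.cover t ht
      have hn : ∀ i, ¬ LozengeIn l (Q i) := fun i h => hi ⟨i, h t hlt⟩
      exact ⟨l, hlt, hT'.2 l hl hn, hT''.2 l hl hn⟩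
  refine eq_of_subset fun l hl => ?_
  obtain ⟨t, ht, hlt⟩ := (T'.subset l hl).isEdgeOf
  obtain ⟨l', hlt', hl', hl''⟩ := hcommon t ht
  rwa [T'.eq_of_mem ht hl hl' hlt hlt']

lemma Tiling.IsRetiling.slope_eq (hT' : T.IsRetiling U T') {t : Tri} (ht : t ∈ D)
    (htQ : ∀ i, t ∉ Q i) {e : Edge} (he : e ∈ triEdges t) : T'.slope e = T.slope e := by
  have hkeep : ∀ l ∈ T.lozenges, l ∈ triEdges t → l ∈ T'.lozenges := fun l hl hlt =>
    hT'.2 l hl fun i h => htQ i (h t hlt)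
  have hiff : e ∈ T'.lozenges ↔ e ∈ T.lozenges := by
    refine ⟨fun hm => ?_, fun hm => hkeep e hm he⟩
    obtain ⟨l, ⟨hl, hlt⟩, -⟩ := T.cover t ht
    rwa [T'.eq_of_mem ht hm (hkeep l hl hlt) he hlt]
  simp only [slope, hiff]

lemma exists_glued_function (hQ : Pairwise (Function.onFun Disjoint Q)) {f : ι → Vertex → ℤ}
    (hf : ∀ i v, IsContourVertex (Q i) v → f i v = 0) :
    ∃ g : Vertex → ℤ, (∀ i v, IsVertexOf (Q i) v → g v = f i v) ∧
      ∀ v, (∀ i, ¬ IsInteriorVertex (Q i) v) → g v = 0 := by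
  classical
  let g : Vertex → ℤ := fun v =>
    if h : ∃ i, IsInteriorVertex (Q i) v then f h.choose v else 0
  have hzero : ∀ v, (∀ i, ¬ IsInteriorVertex (Q i) v) → g v = 0 := fun v hv =>
    dif_neg (not_exists.2 hv)
  have heq : ∀ i j v, IsVertexOf (Q i) v → IsInteriorVertex (Q j) v → i = j := by
    rintro i j v ⟨t, ht, hvt⟩ hj
    exact hQ.eq (Finset.not_disjoint_iff.2 ⟨t, ht, hj t hvt⟩)
  refine ⟨g, fun i v hv => ?_, hzero⟩
  by_cases hint : ∃ j, IsInteriorVertex (Q j) v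
  · rw [heq i _ v hv hint.choose_spec]
    exact dif_pos hint
  · rw [not_exists] at hint
    rw [hzero v hint, hf i v (by_contra fun hc => hint i (hv.isInteriorVertex hc))]

lemma Tiling.IsRetiling.le (hT' : T.IsRetiling U T') (hQ : Pairwise (Function.onFun Disjoint Q))
    (hS : ∀ i, (S i).lozenges ⊆ T.lozenges) (hle : ∀ i, S i ≤ U i) {h : Vertex → ℤ}
    (hT : T.IsHeight h) : T ≤ T' := by
  choose k k' hk hk' hc hkle using hle
  obtain ⟨g, hgQ, hgout⟩ := exists_glued_function hQ (f := fun i => k' i - k i)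
    fun i v hv => sub_eq_zero.2 (hc i v hv).symm
  refine ⟨h, h + g, hT, isHeight_iff.2 fun e he => ?_, fun v hv => ?_, fun v _ => ?_⟩
  · obtain ⟨t, ht, het⟩ := id he
    rw [inc_add, hT.inc_eq_slope he]
    by_cases hi : ∃ i, t ∈ Q i
    · obtain ⟨i, hi⟩ := hi
      have heQ : IsEdgeOf (Q i) e := ⟨t, hi, het⟩
      have hinc : inc g e = inc (k' i - k i) e := by
        rw [inc, inc, hgQ i _ heQ.isVertexOf_fst, hgQ i _ heQ.isVertexOf_fst_add_dir]
      rw [hinc, inc_sub, (hk i).inc_eq_slope heQ, (hk' i).inc_eq_slope heQ,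
        ← slope_eq_of_subset (hS i) heQ, ← slope_eq_of_subset (hT'.1 i) heQ, add_sub_cancel]
    · rw [not_exists] at hi
      have hzero : ∀ v ∈ triVertices t, g v = 0 := fun v hv =>
        hgout v fun i hint => hi i (hint t hv)
      rw [hT'.slope_eq ht hi het, inc, hzero _ (fst_add_dir_mem_triVertices het),
        hzero _ (fst_mem_triVertices het), sub_self, add_zero]
  · rw [Pi.add_apply, hgout v, add_zero]
    exact fun i hint => hv.not_isInteriorVertex fun t ht => domain_subset (hS i) (hint t ht)
  · refine le_add_of_nonneg_right ?_
    by_cases hint : ∃ i, IsInteriorVertex (Q i) v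
    · obtain ⟨i, hint⟩ := hint
      rw [hgQ i v hint.isVertexOf]
      exact sub_nonneg.2 (hkle i v hint.isVertexOf)
    · exact (hgout v (not_exists.1 hint)).ge

end Retiling

/-! ### Ranges of seeds -/

lemma point_eq (v : Vertex) (q : Fin 3 → ℕ) :
    point v q = (v.1 + q 0 - q 2, v.2 + q 1 - q 2) := by
  ext <;> simp [point, Fin.sum_univ_three, dir] <;> ring

lemma point_zero (v : Vertex) : point v 0 = v := by simp [point]

lemma point_add (v : Vertex) (q r : Fin 3 → ℕ) : point v (q + r) = point (point v q) r := by
  simp [point, add_smul, Finset.sum_add_distrib, add_assoc]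

lemma point_update (v : Vertex) (q : Fin 3 → ℕ) (k : Fin 3) (m : ℕ) :
    point v (Function.update q k m) = point v q + ((m : ℤ) - q k) • dir k := by
  rw [point_eq, point_eq]
  fin_cases k <;> ext <;> simp [dir] <;> ring

lemma point_left_injective (q : Fin 3 → ℕ) : Function.Injective fun v => point v q :=
  fun _ _ h => add_right_cancel h

lemma eq_of_point_eq {v : Vertex} {i : Fin 3} {q r : Fin 3 → ℕ} (hq : q i = 0) (hr : r i = 0)
    (h : point v q = point v r) : q = r := by
  rw [point_eq, point_eq, Prod.mk.injEq] at h
  ext j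
  fin_cases i <;> fin_cases j <;>
    simp only [Fin.zero_eta, Fin.mk_one, Fin.reduceFinMk] at * <;> omega

/-- The projection of the unit square of `ℤ³` orthogonal to the axis `i` whose lowest corner is `q`,
relative to an origin that projects onto `v`. For `q i = 0` these squares form the three coordinate
quadrants at the origin, so that their projections tile the plane. -/
def floorLozenge (v : Vertex) (i : Fin 3) (q : Fin 3 → ℕ) : Lozenge := (point v q - dir i, i)

lemma exists_floorLozenge_mem_triEdges (v : Vertex) (t : Tri) :
    ∃ i q, q i = 0 ∧ floorLozenge v i q ∈ triEdges t := by
  obtain ⟨a, b⟩ := v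
  obtain ⟨⟨x, y⟩, c⟩ := t
  simp only [floorLozenge, point_eq]
  by_cases h : a ≤ x ∧ b ≤ y
  · refine ⟨2, ![(x - a).toNat, (y - b).toNat, 0], rfl, ?_⟩
    cases c <;> simp [triEdges, dir] <;> omega
  by_cases h' : x - a < y - b ∨ (c = true ∧ x - a = y - b)
  · refine ⟨0, ![0, (y - b - (x - a) - if c then 0 else 1).toNat, (a - x - 1).toNat], rfl, ?_⟩
    cases c <;> simp [triEdges, dir] at h' ⊢ <;> omega
  · refine ⟨1, ![(x - a - (y - b) - if c then 1 else 0).toNat, 0, (b - y - 1).toNat], rfl, ?_⟩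
    cases c <;> simp [triEdges, dir] at h' ⊢ <;> omega

lemma floorLozenge_injective {v : Vertex} {i j : Fin 3} {q r : Fin 3 → ℕ} (hq : q i = 0)
    (hr : r j = 0) (h : floorLozenge v i q = floorLozenge v j r) : i = j ∧ q = r := by
  obtain ⟨hpoint, rfl⟩ := Prod.mk.inj h
  exact ⟨rfl, eq_of_point_eq hq hr (sub_left_injective hpoint)⟩

lemma floorLozenge_eq_of_mem_triEdges {v : Vertex} {t : Tri} {i j : Fin 3} {q r : Fin 3 → ℕ}
    (hq : q i = 0) (hr : r j = 0) (hqt : floorLozenge v i q ∈ triEdges t)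
    (hrt : floorLozenge v j r ∈ triEdges t) : i = j ∧ q = r := by
  obtain rfl : i = j := by
    obtain ⟨a, b⟩ := v
    obtain ⟨⟨x, y⟩, c⟩ := t
    rw [floorLozenge, point_eq] at hqt hrt
    fin_cases i <;> fin_cases j <;> first
      | rfl
      | (exfalso
         cases c <;> simp [triEdges, dir] at hqt hrt hq hr <;> omega)
  have hpoint := (mem_triEdges_iff.1 hqt).trans (mem_triEdges_iff.1 hrt).symm
  refine ⟨rfl, eq_of_point_eq (v := v) hq hr ?_⟩
  cases h : t.2 <;> simpa [edgeTri, floorLozenge, h] using hpoint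

lemma exists_ge_of_mem_triVertices {v : Vertex} {t : Tri} {i : Fin 3} {q : Fin 3 → ℕ}
    (hq : q i = 0) (ht : floorLozenge v i q ∈ triEdges t) {u : Vertex} (hu : u ∈ triVertices t) :
    ∃ r, q ≤ r ∧ r i = 0 ∧ point v r = u := by
  obtain ⟨d, hd, rfl⟩ : ∃ d : Fin 3 → ℕ, d i = 0 ∧ point (point v q) d = u := by
    rw [floorLozenge] at ht
    generalize point v q = w at ht
    obtain ⟨a, b⟩ := w
    obtain ⟨⟨x, y⟩, c⟩ := t
    obtain ⟨m, n⟩ := u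
    refine ⟨![![0, (n - b - (m - a)).toNat, (a - m).toNat], ![(m - a - (n - b)).toNat, 0,
      (b - n).toNat], ![(m - a).toNat, (n - b).toNat, 0]] i, by fin_cases i <;> rfl, ?_⟩
    rw [point_eq]
    fin_cases i <;> cases c <;> simp [triEdges, triVertices, dir] at ht hu ⊢ <;> omega
  exact ⟨q + d, le_self_add, by rw [Pi.add_apply, hq, hd], point_add v q d⟩

lemma IsCompactPile.mem_baseLozenges_iff {v : Vertex} {P : Finset (Fin 3 → ℕ)}
    (hP : IsCompactPile P) {l : Lozenge} :
    l ∈ baseLozenges v P ↔ ∃ q ∈ P, ∃ i, q i = 0 ∧ l = floorLozenge v i q := by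
  constructor
  · rintro ⟨p, hp, i, rfl⟩
    exact ⟨Function.update p i 0, hP.2 (update_le_self_iff.2 (Nat.zero_le _)) hp, i,
      Function.update_self .., rfl⟩
  · rintro ⟨q, hq, i, hqi, rfl⟩
    exact ⟨q, hq, i, by rw [← hqi, Function.update_eq_self]; rfl⟩

namespace Tiling

variable {T : Tiling D} {v v' : Vertex}

/-- The lozenges of `T` that tile the range of the seed at `v`. -/
def rangeLozenges (T : Tiling D) (v : Vertex) : Set Lozenge :=
  {l | ∃ P, T.HasPseudoHexagon v P ∧ l ∈ baseLozenges v P}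

lemma rangeLozenges_subset : T.rangeLozenges v ⊆ T.lozenges := by
  rintro l ⟨P, hP, hl⟩
  exact hP.2 hl

lemma mem_range {t : Tri} : t ∈ T.range v ↔ ∃ l ∈ T.rangeLozenges v, l ∈ triEdges t := by
  simp only [range, Finset.mem_filter]
  constructor
  · rintro ⟨-, P, hP, l, hl, hlt⟩
    exact ⟨l, ⟨P, hP, hl⟩, hlt⟩
  · rintro ⟨l, ⟨P, hP, hl⟩, hlt⟩
    exact ⟨T.subset l (hP.2 hl) t hlt, P, hP, l, hl, hlt⟩

lemma exists_eq_floorLozenge {l : Lozenge} (hl : l ∈ T.rangeLozenges v) :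
    ∃ i q, q i = 0 ∧ l = floorLozenge v i q := by
  obtain ⟨P, hP, hl⟩ := hl
  obtain ⟨q, -, i, hqi, rfl⟩ := hP.1.mem_baseLozenges_iff.1 hl
  exact ⟨i, q, hqi, rfl⟩

lemma floorLozenge_mem_of_le {i k : Fin 3} {q r : Fin 3 → ℕ}
    (hq : floorLozenge v i q ∈ T.rangeLozenges v) (hqi : q i = 0) (hrq : r ≤ q) (hrk : r k = 0) :
    floorLozenge v k r ∈ T.rangeLozenges v := by
  obtain ⟨P, hP, hl⟩ := hq
  obtain ⟨p, hp, j, hpj, heq⟩ := hP.1.mem_baseLozenges_iff.1 hl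
  obtain ⟨rfl, rfl⟩ := floorLozenge_injective hqi hpj heq
  exact ⟨P, hP, hP.1.mem_baseLozenges_iff.2 ⟨r, hP.1.2 hrq hp, k, hrk, rfl⟩⟩

lemma floorLozenge_mem_of_mem_range {t : Tri} {i : Fin 3} {q : Fin 3 → ℕ} (ht : t ∈ T.range v)
    (hqi : q i = 0) (hqt : floorLozenge v i q ∈ triEdges t) :
    floorLozenge v i q ∈ T.rangeLozenges v := by
  obtain ⟨l, hl, hlt⟩ := mem_range.1 ht
  obtain ⟨j, r, hrj, rfl⟩ := exists_eq_floorLozenge hl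
  obtain ⟨rfl, rfl⟩ := floorLozenge_eq_of_mem_triEdges hqi hrj hqt hlt
  exact hl

lemma le_of_point_eq {i k : Fin 3} {q q' : Fin 3 → ℕ} (hqi : q i = 0) (hqi' : q' i = 0)
    (hq : floorLozenge v i q ∈ T.rangeLozenges v)
    (hq' : floorLozenge v' i q' ∈ T.rangeLozenges v') (h : point v q = point v' q') :
    q' k ≤ q k := by
  by_contra! hlt
  have hki : k ≠ i := by
    rintro rfl
    omega
  -- Going back from the common point along `dir k`, the first floor ends at the wall orthogonal to
  -- the axis `k`, while the second floor goes on and overlaps this wall.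
  have hwall : floorLozenge v k (Function.update q k 0) ∈ T.lozenges :=
    rangeLozenges_subset (floorLozenge_mem_of_le hq hqi
      (update_le_self_iff.2 (Nat.zero_le _)) (Function.update_self ..))
  have hfloor : floorLozenge v' i (Function.update q' k (q' k - (q k + 1))) ∈ T.lozenges :=
    rangeLozenges_subset (floorLozenge_mem_of_le hq' hqi'
      (update_le_self_iff.2 (Nat.sub_le ..)) (by rwa [Function.update_of_ne hki.symm]))
  have hcorner : point v' (Function.update q' k (q' k - (q k + 1))) =
      point v (Function.update q k 0) - dir k := by
    rw [point_update, point_update, ← h, Nat.cast_sub hlt]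
    push_cast
    module
  rw [floorLozenge, hcorner] at hfloor
  exact T.not_consecutive hki.symm hfloor hwall

theorem eq_of_mem_range {t : Tri} (ht : t ∈ T.range v) (ht' : t ∈ T.range v') : v = v' := by
  obtain ⟨l, hl, hlt⟩ := mem_range.1 ht
  obtain ⟨l', hl', hlt'⟩ := mem_range.1 ht'
  have htD : t ∈ D := T.subset l (rangeLozenges_subset hl) t hlt
  obtain rfl := T.eq_of_mem htD (rangeLozenges_subset hl) (rangeLozenges_subset hl') hlt hlt'
  obtain ⟨i, q, hqi, rfl⟩ := exists_eq_floorLozenge hl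
  obtain ⟨i', q', hqi', heq⟩ := exists_eq_floorLozenge hl'
  obtain ⟨hpoint, rfl⟩ := Prod.mk.inj heq
  replace hpoint : point v q = point v' q' := sub_left_injective hpoint
  rw [heq] at hl'
  obtain rfl : q = q' := funext fun k => le_antisymm
    (le_of_point_eq hqi' hqi hl' hl hpoint.symm) (le_of_point_eq hqi hqi' hl hl' hpoint)
  exact point_left_injective q hpoint

lemma exists_lozenges_subset (T : Tiling D) (v : Vertex) :
    ∃ S : Tiling (T.range v), S.lozenges ⊆ T.lozenges := by
  obtain ⟨S, hS⟩ : ∃ S : Tiling (T.range v), ∀ l, l ∈ S.lozenges ↔ l ∈ T.rangeLozenges v := by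
    refine exists_tiling_of_set (fun l hl t ht => mem_range.2 ⟨l, hl, ht⟩) fun t ht => ?_
    obtain ⟨l, hl, hlt⟩ := mem_range.1 ht
    have hlT := rangeLozenges_subset hl
    exact ⟨l, ⟨hl, hlt⟩, fun l' ⟨hl', hlt'⟩ =>
      T.eq_of_mem (T.subset l hlT t hlt) (rangeLozenges_subset hl') hlT hlt' hlt⟩
  exact ⟨S, fun l hl => rangeLozenges_subset ((hS l).1 hl)⟩

lemma HasSeed.hasPseudoHexagon (hs : T.HasSeed v) : T.HasPseudoHexagon v {0} := by
  have hP : IsCompactPile {(0 : Fin 3 → ℕ)} := by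
    refine ⟨Finset.singleton_nonempty 0, ?_⟩
    rw [Finset.coe_singleton]
    rintro p q hqp rfl
    exact le_antisymm hqp (fun _ => Nat.zero_le _)
  refine ⟨hP, fun l hl => ?_⟩
  obtain ⟨q, hq, i, -, rfl⟩ := hP.mem_baseLozenges_iff.1 hl
  rw [Finset.mem_singleton.1 hq, floorLozenge, point_zero]
  exact hs i

lemma HasSeed.isEdgeOf_range (hs : T.HasSeed v) (i : Fin 3) :
    IsEdgeOf (T.range v) (v - dir i, i) := by
  have hmem : (v - dir i, i) ∈ T.rangeLozenges v := by
    refine ⟨{0}, hs.hasPseudoHexagon, hs.hasPseudoHexagon.1.mem_baseLozenges_iff.2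
      ⟨0, Finset.mem_singleton_self 0, i, rfl, ?_⟩⟩
    rw [floorLozenge, point_zero]
  have htri := mem_triEdges_edgeTri (v - dir i, i) false
  exact ⟨_, mem_range.2 ⟨_, hmem, htri⟩, htri⟩

lemma eq_of_floorLozenge_notMem {f g : Vertex → ℤ} (hc : AgreeOnContour D f g)
    (hinc : ∀ t ∈ D, t ∉ T.range v → ∀ e ∈ triEdges t, inc f e = inc g e) {i : Fin 3}
    {q : Fin 3 → ℕ} (hqi : q i = 0) (hq : floorLozenge v i q ∉ T.rangeLozenges v)
    (hv : IsVertexOf D (point v q)) : f (point v q) = g (point v q) := by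
  obtain ⟨j, hji⟩ := exists_ne i
  -- The quadrant minus the range is stable under `dir j`, which leads out of the domain.
  refine walk_induction (p := fun u => IsVertexOf D u → ∀ q, q i = 0 →
    floorLozenge v i q ∉ T.rangeLozenges v → point v q = u → f u = g u)
    (finite_setOf_isVertexOf D) j (fun u hu hu' => absurd hu' hu) ?_ _ hv q hqi hq rfl
  rintro _ - ih hu q hqi hq rfl
  by_cases hcon : IsContourVertex D (point v q)
  · exact hc _ hcon
  obtain ⟨t, hit, hjt⟩ := exists_mem_triEdges_of_consecutive (point v q) hji.symm
  have htD : t ∈ D := hu.isInteriorVertex hcon t (fst_mem_triVertices hjt)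
  have hqi' : Function.update q j (q j + 1) i = 0 := by rwa [Function.update_of_ne hji.symm]
  have hq' : floorLozenge v i (Function.update q j (q j + 1)) ∉ T.rangeLozenges v := fun hm =>
    hq (floorLozenge_mem_of_le hm hqi' (le_update_self_iff.2 (Nat.le_succ _)) hqi)
  have hnext := ih ⟨t, htD, fst_add_dir_mem_triVertices hjt⟩ _ hqi' hq' (by simp [point_update])
  have hstep := hinc t htD (fun ht => hq (floorLozenge_mem_of_mem_range ht hqi hit)) _ hjt
  rwa [inc, inc, hnext, sub_right_inj] at hstep

end Tiling

theorem HasConsistentHeights.range (hD : HasConsistentHeights D) (T : Tiling D) (v : Vertex) :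
    HasConsistentHeights (T.range v) := by
  obtain ⟨S, hS⟩ := T.exists_lozenges_subset v
  intro A B
  have hQ : Pairwise (Function.onFun Disjoint fun _ : Unit => T.range v) :=
    Subsingleton.pairwise
  obtain ⟨TA, hTA⟩ := Tiling.exists_isRetiling hQ (fun _ => hS) fun _ => A
  obtain ⟨TB, hTB⟩ := Tiling.exists_isRetiling hQ (fun _ => hS) fun _ => B
  obtain ⟨f, g, hf, hg, hc⟩ := hD TA TB
  refine ⟨f, g, hf.of_subset (hTA.1 ()), hg.of_subset (hTB.1 ()), fun u hu => ?_⟩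
  obtain ⟨t, ht, hut⟩ := hu.exists_notMem
  obtain ⟨i, q, hqi, hqt⟩ := exists_floorLozenge_mem_triEdges v t
  obtain ⟨r, hqr, hri, rfl⟩ := exists_ge_of_mem_triVertices hqi hqt hut
  refine Tiling.eq_of_floorLozenge_notMem (T := T) hc (fun t htD htQ e he => ?_) hri
    (fun hr => ht ?_) (hu.isVertexOf.mono (Tiling.domain_subset hS))
  · rw [hf.inc_eq_slope ⟨t, htD, he⟩, hg.inc_eq_slope ⟨t, htD, he⟩,
      hTA.slope_eq htD (fun _ => htQ) he, hTB.slope_eq htD (fun _ => htQ) he]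
  · exact Tiling.mem_range.2 ⟨_, Tiling.floorLozenge_mem_of_le hr hri hqr hqi, hqt⟩

/-! ### Proper seeds and maximal fillings -/

lemma mem_maxRange_self {T : Tiling D} {v : Vertex} (hs : T.HasSeed v) {h : Vertex → ℤ}
    (hT : T.IsHeight h) : (v, h v) ∈ maxRange D h (v, h v) :=
  ⟨T, h, hT, fun _ _ => rfl, rfl, {0}, hs.hasPseudoHexagon, 0, Finset.mem_singleton_self 0, by
    simp [point_zero]⟩

lemma snd_le_of_mem_maxRange {h : Vertex → ℤ} {s c : Cube} (hc : c ∈ maxRange D h s) :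
    s.2 ≤ c.2 := by
  obtain ⟨-, -, -, -, -, -, -, p, -, rfl⟩ := hc
  exact le_add_of_nonneg_right (Finset.sum_nonneg fun j _ => Int.natCast_nonneg (p j))

lemma eq_of_mem_maxRange_of_snd_le {h : Vertex → ℤ} {s c : Cube} (hc : c ∈ maxRange D h s)
    (hle : c.2 ≤ s.2) : c = s := by
  obtain ⟨-, -, -, -, -, -, -, p, -, rfl⟩ := hc
  obtain rfl : p = 0 := by
    funext j
    have hj : (p j : ℤ) ≤ ∑ j, (p j : ℤ) :=
      Finset.single_le_sum (f := fun j => (p j : ℤ)) (fun j _ => Int.natCast_nonneg (p j))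
        (Finset.mem_univ j)
    dsimp only at hle
    rw [Pi.zero_apply]
    omega
  simp [point_zero]

namespace Tiling

variable {T T' T'' : Tiling D}

lemma exists_hasProperSeed {h : Vertex → ℤ} (hT : T.IsHeight h) (hs : ∃ v, T.HasSeed v) :
    ∃ v, T.HasProperSeed v := by
  have hfin : {v | T.HasSeed v}.Finite :=
    (finite_setOf_isVertexOf D).subset fun v hv => hv.isInteriorVertex.isVertexOf
  obtain ⟨v, hv, hmax⟩ := hfin.exists_maximalFor (fun v => maxRange D h (v, h v)) _ hs
  refine ⟨v, hv, h, hT, fun v' hv' hle => ?_⟩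
  have hmem : (v, h v) ∈ maxRange D h (v', h v') := hle (mem_maxRange_self hv hT)
  have hmem' : (v', h v') ∈ maxRange D h (v, h v) := hmax hv' hle (mem_maxRange_self hv' hT)
  exact congrArg Prod.fst (eq_of_mem_maxRange_of_snd_le hmem' (snd_le_of_mem_maxRange hmem))

lemma pairwise_disjoint_range (T : Tiling D) :
    Pairwise (Function.onFun Disjoint fun v : {v // T.HasProperSeed v} => T.range v) :=
  fun _ _ hne => Finset.disjoint_left.2 fun _ ht ht' => hne (Subtype.ext (eq_of_mem_range ht ht'))

lemma isMaxFilling_iff : T.IsMaxFilling T' ↔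
    ∃ U : ∀ v : {v // T.HasProperSeed v}, Tiling (T.range v),
      (∀ v, (U v).IsMaximal) ∧ T.IsRetiling U T' := by
  constructor
  · rintro ⟨hU, hT'⟩
    choose U hU hUT' using hU
    exact ⟨fun v => U v v.2, fun v => hU v v.2, fun v => hUT' v v.2,
      fun l hl hn => hT' l hl fun v hv => hn ⟨v, hv⟩⟩
  · rintro ⟨U, hU, hUT', hT'⟩
    exact ⟨fun v hv => ⟨U ⟨v, hv⟩, hU ⟨v, hv⟩, hUT' ⟨v, hv⟩⟩,
      fun l hl hn => hT' l hl fun v => hn v v.2⟩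

lemma IsMaxFilling.unique (hT' : T.IsMaxFilling T') (hT'' : T.IsMaxFilling T'') : T' = T'' := by
  obtain ⟨U, hU, hT'⟩ := isMaxFilling_iff.1 hT'
  obtain ⟨U', hU', hT''⟩ := isMaxFilling_iff.1 hT''
  obtain rfl : U = U' := funext fun v => (hU v).eq (hU' v)
  exact hT'.unique hT''

lemma IsMaxFilling.le (hT' : T.IsMaxFilling T') {h : Vertex → ℤ} (hT : T.IsHeight h) :
    T ≤ T' := by
  obtain ⟨U, hU, hT'⟩ := isMaxFilling_iff.1 hT'
  choose S hS using T.exists_lozenges_subset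
  exact hT'.le T.pairwise_disjoint_range (fun v => hS v) (fun v => hU v (S v)) hT

end Tiling

namespace HasConsistentHeights

variable {T T' : Tiling D}

lemma exists_isMaxFilling (hD : HasConsistentHeights D) (T : Tiling D) :
    ∃ T' : Tiling D, T.IsMaxFilling T' := by
  choose S hS using T.exists_lozenges_subset
  have hU : ∀ v, ∃ U : Tiling (T.range v), U.IsMaximal := fun v =>
    have : Nonempty (Tiling (T.range v)) := ⟨S v⟩
    (hD.range T v).exists_isMaximal
  choose U hU using hU
  obtain ⟨T', hT'⟩ :=
    Tiling.exists_isRetiling T.pairwise_disjoint_range (fun v => hS v) fun v => U v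
  exact ⟨T', Tiling.isMaxFilling_iff.2 ⟨fun v => U v, fun v => hU v, hT'⟩⟩

lemma ne_of_isMaxFilling (hD : HasConsistentHeights D) (hT' : T.IsMaxFilling T')
    (hT : ¬ T.IsMaximal) : T ≠ T' := by
  rintro rfl
  obtain ⟨h, hh⟩ := hD.exists_isHeight T
  obtain ⟨v, hv⟩ := Tiling.exists_hasProperSeed hh (hD.exists_hasSeed hT)
  obtain ⟨U, hU, hUT⟩ := hT'.1 v hv
  obtain ⟨k, hk⟩ := (hD.range T v).exists_isHeight U
  have hseed : U.HasSeed v := fun i =>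
    (Tiling.mem_iff_of_subset hUT (hv.1.isEdgeOf_range i)).2 (hv.1 i)
  exact hU.not_hasSeed hk v hseed

lemma existsUnique_isFillingSequence (hD : HasConsistentHeights D) [Nonempty (Tiling D)] :
    ∃! E : ℕ → Tiling D, IsFillingSequence E := by
  obtain ⟨T₀, hT₀⟩ := hD.exists_isMinimal
  choose fill hfill using hD.exists_isMaxFilling
  refine ⟨fun n => fill^[n] T₀, ⟨hT₀, fun n => ?_⟩, fun E hE => funext fun n => ?_⟩
  · simp only [Function.iterate_succ_apply']
    exact hfill _
  · induction n with
    | zero => exact hE.1.eq hT₀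
    | succ n ih =>
      simp only [Function.iterate_succ_apply', ← ih]
      exact (hE.2 n).unique (hfill _)

lemma exists_isLeast (hD : HasConsistentHeights D) {E : ℕ → Tiling D}
    (hE : IsFillingSequence E) : ∃ d : ℕ, IsLeast {n | (E n).IsMaximal} d := by
  classical
  suffices hex : ∃ n, (E n).IsMaximal from
    ⟨Nat.find hex, Nat.find_spec hex, fun n hn => Nat.find_min' hex hn⟩
  by_contra! hcon
  let := hD.partialOrder
  have hlt : StrictMono E := strictMono_nat_of_lt_succ fun n => by
    obtain ⟨h, hh⟩ := hD.exists_isHeight (E n)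
    exact lt_of_le_of_ne ((hE.2 n).le hh) (hD.ne_of_isMaxFilling (hE.2 n) (hcon n))
  exact not_injective_infinite_finite E hlt.injective

end HasConsistentHeights

/-! ### The chain of intervals -/

lemma exists_not_le_and_not_le {α : Type*} [Preorder α] {f : ℕ → α} {a b : α} {d : ℕ}
    (ha : f 0 ≤ a) (hb : b ≤ f d) (hab : ¬ b ≤ a) : ∃ n < d, ¬ b ≤ f n ∧ ¬ f (n + 1) ≤ a := by
  induction d with
  | zero => exact absurd (hb.trans ha) hab
  | succ d ih =>
    by_cases hd : b ≤ f d
    · obtain ⟨n, hn, h⟩ := ih hd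
      exact ⟨n, hn.trans d.lt_succ_self, h⟩
    · exact ⟨d, d.lt_succ_self, hd, fun h => hab (hb.trans h)⟩

lemma HasConsistentHeights.isMaxChain (hD : HasConsistentHeights D) {E : ℕ → Tiling D} {d : ℕ}
    (hmin : (E 0).IsMinimal) (hmax : (E d).IsMaximal) (hle : ∀ n, E n ≤ E (n + 1))
    (hne : ∀ n < d, E n ≠ E (n + 1)) :
    IsMaxChain TilingInterval.Precedes
      {I : TilingInterval D | ∃ n < d, I.lo = E n ∧ I.hi = E (n + 1)} := by
  let := hD.partialOrder
  have hmono : ∀ {m n}, m ≤ n → E m ≤ E n := fun h => monotone_nat_of_le_succ hle h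
  refine ⟨?_, fun C hC hsub => hsub.antisymm fun J hJ => ?_⟩
  · rintro ⟨_, _, _, _⟩ ⟨m, -, rfl, rfl⟩ ⟨_, _, _, _⟩ ⟨n, -, rfl, rfl⟩ hIJ
    rcases lt_trichotomy m n with h | rfl | h
    · exact Or.inl (hmono h)
    · exact absurd rfl hIJ
    · exact Or.inr (hmono h)
  · obtain ⟨n, hn, hhi, hlo⟩ := exists_not_le_and_not_le (hmin J.lo) (hmax J.hi)
      fun h => J.ne (Tiling.le_antisymm J.le h)
    let I : TilingInterval D := ⟨E n, E (n + 1), hle n, hne n hn⟩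
    have hIC : I ∈ C := hsub ⟨n, hn, rfl, rfl⟩
    obtain rfl : J = I := by
      by_contra hJI
      exact (hC hJ hIC hJI).elim hhi hlo
    exact ⟨n, hn, rfl, rfl⟩

end LozengeTiling

theorem mainTheorem6 (D : Domain) (hT : Nonempty (Tiling D))
    (hD : IsPolygon D ∨ HasConsistentHeights D) :
    (∃! E : ℕ → Tiling D, IsFillingSequence E) ∧
    ∀ E : ℕ → Tiling D, IsFillingSequence E →
      ∃ d : ℕ, IsLeast {n | (E n).IsMaximal} d ∧
        (E 0).IsMinimal ∧ (E d).IsMaximal ∧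
        (∀ n < d, E n ≤ E (n + 1) ∧ E n ≠ E (n + 1)) ∧
        IsMaxChain TilingInterval.Precedes
          {I : TilingInterval D | ∃ n < d, I.lo = E n ∧ I.hi = E (n + 1)} := by
  have hC : HasConsistentHeights D :=
    hD.elim (fun h => IsComplementConnected.hasConsistentHeights h.2) id
  refine ⟨hC.existsUnique_isFillingSequence, fun E hE => ?_⟩
  obtain ⟨d, hd⟩ := hC.exists_isLeast hE
  have hle : ∀ n, E n ≤ E (n + 1) := fun n =>
    let ⟨_, hheight⟩ := hC.exists_isHeight (E n)
    (hE.2 n).le hheight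
  have hne : ∀ n < d, E n ≠ E (n + 1) := fun n hn =>
    hC.ne_of_isMaxFilling (hE.2 n) fun h => (hd.2 h).not_gt hn
  exact ⟨d, hd, hE.1, hd.1, fun n hn => ⟨hle n, hne n hn⟩, hC.isMaxChain hE.1 hd.1 hle hne⟩
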